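/- Let $0\le\gamma<1$, $\delta>0$, and put $\kappa_1=\frac1{\delta+\gamma}$, $\kappa_2=1-\gamma$, $\lambda=\frac{\delta^2-\gamma}{(\delta+\gamma)^2}$. Let $b,d>0$ and let either $a=0,\ c<0$ (Bona--Smith systems) or $a<0,\ c=0$; put $c'=(1-\gamma)c$. Let $T>0$ and let $\mu\ge 1$ be real. For real $1$-periodic $f\in L^2(0,1)$ with Fourier coefficients $\hat f(k)=\int_0^1 f(x)e^{-2\pi ikx}\,dx$, let $(\cdot,\cdot)$ and $\|\cdot\|$ be the inner product and norm of $L^2(0,1)$, and let $H^\mu$ be the space of those $f$ with $\|f\|_\mu=\big(\sum_{k\in\mathbb Z}(1+k^2)^\mu|\hat f(k)|^2\big)^{1/2}<\infty$. Suppose that $\zeta,u\in C^1([0,T];H^\mu)$ solve, in the sense of periodic distributions in $x$ for each $t\in[0,T]$, the periodic initial-value problem $$\zeta_t+\kappa_1u_x+\lambda(\zeta u)_x+a\,u_{xxx}-b\,\zeta_{xxt}=0,\qquad u_t+\kappa_2\zeta_x+\lambda uu_x+c'\zeta_{xxx}-d\,u_{xxt}=0,$$ with $\zeta(0)=\zeta_0$,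 $u(0)=u_0$. For $N\ge1$ let $S_N=\mathrm{span}\{e^{2\pi ikx}:k\in\mathbb Z,\ |k|\le N\}$, let $P$ be the $L^2$-projection onto $S_N$, and consider the spectral Galerkin semidiscretization: find real-valued $\zeta_N,u_N:[0,T]\to S_N$, differentiable in $t$, with $\zeta_N(0)=P\zeta_0$, $u_N(0)=Pu_0$ and, for all $t\in[0,T]$ and all $\varphi,\chi\in S_N$, $$(\zeta_{Nt},\varphi)+\kappa_1(u_{Nx},\varphi)+\lambda((\zeta_Nu_N)_x,\varphi)+a(u_{Nxxx},\varphi)-b(\zeta_{Nxxt},\varphi)=0,$$ $$(u_{Nt},\chi)+\kappa_2(\zeta_{Nx},\chi)+\lambda(u_Nu_{Nx},\chi)+c'(\zeta_{Nxxx},\chi)-d(u_{Nxxt},\chi)=0.$$ Then: (1) there is $N_0$ such that for every $N\ge N_0$ the semidiscrete problem has a solution on the whole interval $[0,T]$; (2) for every $N\ge1$ it has at most one solution on $[0,T]$; (3) there is a constant $C>0$, independent of $N$, such that for every $N\ge1$ for which the semidiscrete solution exists on $[0,T]$ (in particular for every $N\ge\max(1,N_0)$), $$\max_{0\le t\le T}\big(\|\zeta_N-\zeta\|+\|u_N-u\|\big)\le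 C\,N^{-\mu}.$$ -/

import Mathlib

open MeasureTheory AddCircle Set
open scoped ComplexConjugate ContDiff ENNReal

/-! ### Periodic Sobolev spaces `H^μ` of real 1-periodic functions -/

/-- Real-valued `L²` functions on the circle of length `1`. -/
abbrev L2Per : Type := Lp ℝ 2 (haarAddCircle : Measure UnitAddCircle)

/-- The `k`-th Fourier coefficient `∫₀¹ f(x) e^{-2πikx} dx` of `f`. -/
noncomputable def perCoeff (f : L2Per) (k : ℤ) : ℂ :=
  fourierCoeff (fun x : UnitAddCircle => ((f x : ℝ) : ℂ)) k

/-- The weighted sequence `(1 + k²)^{μ/2} f̂(k)`. -/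
noncomputable def weightedCoeff (μ : ℝ) (f : L2Per) (k : ℤ) : ℂ :=
  (((1 + (k : ℝ) ^ 2) ^ (μ / 2) : ℝ) : ℂ) * perCoeff f k

theorem perCoeff_add (f g : L2Per) (k : ℤ) :
    perCoeff (f + g) k = perCoeff f k + perCoeff g k := by
  have hf : Integrable (fun x : UnitAddCircle => ((f x : ℝ) : ℂ)) haarAddCircle :=
    ((Lp.memLp f).integrable one_le_two).ofReal
  have hg : Integrable (fun x : UnitAddCircle => ((g x : ℝ) : ℂ)) haarAddCircle :=
    ((Lp.memLp g).integrable one_le_two).ofReal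
  have h := congrFun (fourierCoeff.add hf hg) k
  rw [Pi.add_apply] at h
  unfold perCoeff
  rw [← h]
  apply congrFun
  apply fourierCoeff_congr_ae
  filter_upwards [Lp.coeFn_add f g] with x hx
  rw [Pi.add_apply] at hx
  rw [hx]
  exact Complex.ofReal_add _ _

theorem perCoeff_smul (r : ℝ) (f : L2Per) (k : ℤ) :
    perCoeff (r • f) k = (r : ℂ) * perCoeff f k := by
  unfold perCoeff
  rw [← fourierCoeff.const_mul]
  apply congrFun
  apply fourierCoeff_congr_ae
  filter_upwards [Lp.coeFn_smul r f] with x hx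
  simp [hx]

/-- A function is determined by its Fourier coefficients. -/
theorem eq_zero_of_perCoeff (f : L2Per) (h : ∀ k, perCoeff f k = 0) : f = 0 := by
  have hm : MemLp (fun x : UnitAddCircle => ((f x : ℝ) : ℂ)) 2 haarAddCircle :=
    (Lp.memLp f).ofReal
  have hz : hm.toLp = 0 := by
    apply (fourierBasis (T := (1 : ℝ))).repr.injective
    ext k
    rw [fourierBasis_repr, map_zero]
    rw [fourierCoeff_congr_ae hm.coeFn_toLp]
    exact h k
  have h2 := (Lp.eq_zero_iff_ae_eq_zero).1 hz
  apply (Lp.eq_zero_iff_ae_eq_zero).2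
  filter_upwards [h2, hm.coeFn_toLp] with x hx hx'
  rw [hx'] at hx
  simpa using hx

/-- The subspace of those `f ∈ L²` with `∑ (1 + k²)^μ |f̂(k)|² < ∞`. -/
noncomputable def perSobolevSubmodule (μ : ℝ) : Submodule ℝ L2Per where
  carrier := {f | Memℓp (weightedCoeff μ f) 2}
  zero_mem' := by
    have : weightedCoeff μ (0 : L2Per) = 0 := by
      funext k
      have := perCoeff_smul 0 0 k
      simp only [zero_smul, Complex.ofReal_zero, zero_mul] at this
      simp [weightedCoeff, this]
    simp only [mem_ofPred_eq, this]
    exact zero_memℓp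
  add_mem' := by
    intro f g hf hg
    have : weightedCoeff μ (f + g) = weightedCoeff μ f + weightedCoeff μ g := by
      funext k
      simp [weightedCoeff, perCoeff_add, mul_add]
    simp only [mem_ofPred_eq, this]
    exact Memℓp.add hf hg
  smul_mem' := by
    intro r f hf
    have : weightedCoeff μ (r • f) = r • weightedCoeff μ f := by
      funext k
      simp [weightedCoeff, perCoeff_smul]
      ring
    simp only [mem_ofPred_eq, this]
    exact Memℓp.const_smul hf r

/-- The periodic Sobolev space `H^μ` of real 1-periodic functions. It carries the `H^μ` norm
defined below (not the `L²` norm). -/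
def PerSobolev (μ : ℝ) : Type := ↥(perSobolevSubmodule μ)

noncomputable instance (μ : ℝ) : AddCommGroup (PerSobolev μ) :=
  inferInstanceAs (AddCommGroup ↥(perSobolevSubmodule μ))

noncomputable instance (μ : ℝ) : Module ℝ (PerSobolev μ) :=
  inferInstanceAs (Module ℝ ↥(perSobolevSubmodule μ))

/-- The underlying `L²` function. -/
noncomputable def PerSobolev.toL2 {μ : ℝ} : PerSobolev μ →ₗ[ℝ] L2Per :=
  (perSobolevSubmodule μ).subtype

theorem PerSobolev.toL2_injective {μ : ℝ} :
    Function.Injective (PerSobolev.toL2 : PerSobolev μ →ₗ[ℝ] L2Per) :=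
  Subtype.val_injective

/-- The map `f ↦ ((1 + k²)^{μ/2} f̂(k))_k` from `H^μ` to `ℓ²(ℤ)`. -/
noncomputable def PerSobolev.toSeq (μ : ℝ) :
    PerSobolev μ →ₗ[ℝ] lp (fun _ : ℤ => ℂ) 2 where
  toFun f := ⟨weightedCoeff μ f.toL2, f.2⟩
  map_add' f g := by
    ext k
    change weightedCoeff μ (f.toL2 + g.toL2) k
      = weightedCoeff μ f.toL2 k + weightedCoeff μ g.toL2 k
    simp [weightedCoeff, perCoeff_add, mul_add]
  map_smul' r f := by
    ext k
    simp [weightedCoeff, perCoeff_smul]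
    ring

theorem PerSobolev.toSeq_injective (μ : ℝ) : Function.Injective (PerSobolev.toSeq μ) := by
  rw [injective_iff_map_eq_zero]
  intro f hf
  apply PerSobolev.toL2_injective
  rw [map_zero]
  apply eq_zero_of_perCoeff
  intro k
  have h : weightedCoeff μ f.toL2 k = 0 := by
    have := congrArg (fun s : lp (fun _ : ℤ => ℂ) 2 => s k) hf
    simpa [PerSobolev.toSeq] using this
  have hpos : (0 : ℝ) < (1 + (k : ℝ) ^ 2) ^ (μ / 2) := by positivity
  rcases mul_eq_zero.1 h with h0 | h0
  · exact absurd (Complex.ofReal_eq_zero.1 h0) hpos.ne'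
  · exact h0

/-- The `H^μ` norm, `‖f‖_μ = ‖((1 + k²)^{μ/2} f̂(k))_k‖_{ℓ²}`. -/
noncomputable instance (μ : ℝ) : NormedAddCommGroup (PerSobolev μ) :=
  NormedAddCommGroup.induced (PerSobolev μ) (lp (fun _ : ℤ => ℂ) 2) (PerSobolev.toSeq μ)
    (PerSobolev.toSeq_injective μ)

noncomputable instance (μ : ℝ) : NormedSpace ℝ (PerSobolev μ) :=
  NormedSpace.induced ℝ (PerSobolev μ) (lp (fun _ : ℤ => ℂ) 2) (PerSobolev.toSeq μ)

/-- The norm of `H^μ` is `(∑ (1 + k²)^μ |f̂(k)|²)^{1/2}`. -/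
theorem PerSobolev.norm_eq {μ : ℝ} (f : PerSobolev μ) :
    ‖f‖ = Real.sqrt (∑' k : ℤ, (1 + (k : ℝ) ^ 2) ^ μ * ‖perCoeff f.toL2 k‖ ^ 2) := by
  change ‖PerSobolev.toSeq μ f‖ = _
  rw [lp.norm_eq_tsum_rpow (by norm_num), Real.sqrt_eq_rpow]
  have key : ∀ k : ℤ, ‖(PerSobolev.toSeq μ f : lp (fun _ : ℤ => ℂ) 2) k‖ ^ (2 : ℝ≥0∞).toReal
      = (1 + (k : ℝ) ^ 2) ^ μ * ‖perCoeff f.toL2 k‖ ^ 2 := by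
    intro k
    have hk : (0 : ℝ) ≤ 1 + (k : ℝ) ^ 2 := by positivity
    have hk' : (0 : ℝ) ≤ (1 + (k : ℝ) ^ 2) ^ (μ / 2) := by positivity
    change ‖weightedCoeff μ f.toL2 k‖ ^ (2 : ℝ≥0∞).toReal = _
    rw [weightedCoeff, norm_mul, Complex.norm_real, Real.norm_of_nonneg hk']
    simp only [ENNReal.toReal_ofNat, Real.rpow_ofNat, mul_pow]
    rw [← Real.rpow_natCast ((1 + (k : ℝ) ^ 2) ^ (μ / 2)), ← Real.rpow_mul hk]
    norm_num
  simp only [key]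
  norm_num

/-- An element of `H^μ` as a real 1-periodic function on the line. -/
noncomputable def PerSobolev.fn {μ : ℝ} (f : PerSobolev μ) (x : ℝ) : ℝ :=
  (f.toL2 : UnitAddCircle → ℝ) (x : UnitAddCircle)

/-! ### Inner product and norm of `L²(0,1)` -/

/-- `(f, g) = ∫₀¹ f ḡ dx`, for a real function `f` and a complex function `g`. -/
noncomputable def ip (f : ℝ → ℝ) (g : ℝ → ℂ) : ℂ :=
  ∫ x in (0 : ℝ)..1, (f x : ℂ) * conj (g x)

/-- `‖f‖ = (∫₀¹ |f|² dx)^{1/2}`. -/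
noncomputable def l2norm (f : ℝ → ℝ) : ℝ :=
  Real.sqrt (∫ x in (0 : ℝ)..1, f x ^ 2)

/-! ### The coefficients of the system -/

/-- `κ₁ = 1 / (δ + γ)` -/
noncomputable def kappa1 (γ δ : ℝ) : ℝ := 1 / (δ + γ)

/-- `κ₂ = 1 - γ` -/
def kappa2 (γ : ℝ) : ℝ := 1 - γ

/-- `λ = (δ² - γ) / (δ + γ)²` -/
noncomputable def lam (γ δ : ℝ) : ℝ := (δ ^ 2 - γ) / (δ + γ) ^ 2

/-! ### The periodic initial-value problem -/

/-- `(ζ, u)`, with `ζ, u ∈ C¹([0,T]; H^μ)`, is a solution on `[0,T]` of the periodic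
initial-value problem
`ζ_t + κ₁ u_x + λ (ζu)_x + a u_xxx - b ζ_xxt = 0`,
`u_t + κ₂ ζ_x + λ u u_x + (1-γ) c ζ_xxx - d u_xxt = 0`,
`ζ(0) = ζ₀`, `u(0) = u₀`,
the spatial derivatives being taken in the sense of periodic distributions: at each time the
equations are tested with smooth 1-periodic `φ`, and all spatial derivatives are moved to `φ`. -/
structure IsSolution (γ δ a b c d T μ : ℝ) (ζ₀ u₀ : PerSobolev μ) (ζ u : ℝ → PerSobolev μ) :
    Prop where
  contDiffOn_zeta : ContDiffOn ℝ 1 ζ (Icc 0 T)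
  contDiffOn_u : ContDiffOn ℝ 1 u (Icc 0 T)
  eq_zeta : ∀ t ∈ Icc 0 T, ∀ φ : ℝ → ℂ, ContDiff ℝ ∞ φ → Function.Periodic φ 1 →
    ip (derivWithin ζ (Icc 0 T) t).fn φ
      - kappa1 γ δ * ip (u t).fn (deriv φ)
      - lam γ δ * ip (fun x => (ζ t).fn x * (u t).fn x) (deriv φ)
      - a * ip (u t).fn (iteratedDeriv 3 φ)
      - b * ip (derivWithin ζ (Icc 0 T) t).fn (iteratedDeriv 2 φ) = 0
  eq_u : ∀ t ∈ Icc 0 T, ∀ χ : ℝ → ℂ, ContDiff ℝ ∞ χ → Function.Periodic χ 1 →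
    ip (derivWithin u (Icc 0 T) t).fn χ
      - kappa2 γ * ip (ζ t).fn (deriv χ)
      - lam γ δ / 2 * ip (fun x => (u t).fn x ^ 2) (deriv χ)
      - ((1 - γ) * c) * ip (ζ t).fn (iteratedDeriv 3 χ)
      - d * ip (derivWithin u (Icc 0 T) t).fn (iteratedDeriv 2 χ) = 0
  init_zeta : ζ 0 = ζ₀
  init_u : u 0 = u₀

/-! ### The spectral Galerkin semidiscretization -/

/-- The 1-periodic exponential `x ↦ e^{2πikx}`. -/
noncomputable def expMode (k : ℤ) (x : ℝ) : ℂ :=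
  Complex.exp (2 * Real.pi * Complex.I * k * x)

/-- `S_N = span {e^{2πikx} : -N ≤ k ≤ N}`. -/
def trigSpace (N : ℕ) : Submodule ℂ (ℝ → ℂ) :=
  Submodule.span ℂ (expMode '' {k : ℤ | -(N : ℤ) ≤ k ∧ k ≤ N})

/-- The `L²` projection onto `S_N`, `P v = ∑_{|k| ≤ N} v̂(k) e^{2πikx}`. -/
noncomputable def trigProj (N : ℕ) {μ : ℝ} (v : PerSobolev μ) (x : ℝ) : ℂ :=
  ∑ k ∈ Finset.Icc (-(N : ℤ)) N, perCoeff v.toL2 k * expMode k x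

/-- The time derivative on `[0,T]` of a function of `(t, x)`. -/
noncomputable def timeDeriv (T : ℝ) (w : ℝ → ℝ → ℝ) (t x : ℝ) : ℝ :=
  derivWithin (fun s => w s x) (Icc 0 T) t

/-- `ζN, uN`, as functions of `(t, x)`, are real-valued, take values in `S_N` for `0 ≤ t ≤ T`,
and solve on `[0,T]` the semidiscrete problem
`(ζ_Nt, φ) + κ₁ (u_Nx, φ) + λ ((ζ_N u_N)_x, φ) + a (u_Nxxx, φ) - b (ζ_Nxxt, φ) = 0`,
`(u_Nt, χ) + κ₂ (ζ_Nx, χ) + λ (u_N u_Nx, χ) + (1-γ) c (ζ_Nxxx, χ) - d (u_Nxxt, χ) = 0`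
for all `φ, χ ∈ S_N`, with `ζ_N(0) = P ζ₀`, `u_N(0) = P u₀`. -/
structure IsSemidiscreteSolution (γ δ a b c d T μ : ℝ) (ζ₀ u₀ : PerSobolev μ) (N : ℕ)
    (ζN uN : ℝ → ℝ → ℝ) : Prop where
  mem_zeta : ∀ t ∈ Icc 0 T, (fun x => (ζN t x : ℂ)) ∈ trigSpace N
  mem_u : ∀ t ∈ Icc 0 T, (fun x => (uN t x : ℂ)) ∈ trigSpace N
  diff_zeta : ∀ x, DifferentiableOn ℝ (fun t => ζN t x) (Icc 0 T)
  diff_u : ∀ x, DifferentiableOn ℝ (fun t => uN t x) (Icc 0 T)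
  eq_zeta : ∀ t ∈ Icc 0 T, ∀ φ ∈ trigSpace N,
    ip (timeDeriv T ζN t) φ
      + kappa1 γ δ * ip (deriv (uN t)) φ
      + lam γ δ * ip (deriv (fun x => ζN t x * uN t x)) φ
      + a * ip (iteratedDeriv 3 (uN t)) φ
      - b * ip (iteratedDeriv 2 (timeDeriv T ζN t)) φ = 0
  eq_u : ∀ t ∈ Icc 0 T, ∀ χ ∈ trigSpace N,
    ip (timeDeriv T uN t) χ
      + kappa2 γ * ip (deriv (ζN t)) χ
      + lam γ δ * ip (fun x => uN t x * deriv (uN t) x) χ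
      + ((1 - γ) * c) * ip (iteratedDeriv 3 (ζN t)) χ
      - d * ip (iteratedDeriv 2 (timeDeriv T uN t)) χ = 0
  init_zeta : ∀ x, (ζN 0 x : ℂ) = trigProj N ζ₀ x
  init_u : ∀ x, (uN 0 x : ℂ) = trigProj N u₀ x

/-! In Fourier variables, with `ν = 2πk`, both equations can be solved for the time derivative,
because the symbols `1 + bν²` and `1 + dν²` never vanish. The result is an infinite system of
ordinary differential equations; the Galerkin scheme keeps the modes `|k| ≤ N` and drops the rest.

The linear part couples the two unknowns through symbols `-iα` and `-iW²α`, where `p` is `ζ` if `a =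
0` and `u` if `c = 0`, and `q` is the other unknown. In the coordinates `(W p, q)` it is
skew-adjoint and disappears from the energy balance. Since `W` grows like `|k|`, the energy controls
`p` in `H¹` and `q` in `L²`. The nonlinear terms carry a smoothing symbol of order `-1`. In the
equation for `p` every product contains `p`, whose coefficients are summable, and Young's inequality
`ℓ¹ * ℓ² ⊆ ℓ²` applies. The equation for `q` may contain `q * q`, which is only bounded, but its
symbol `B` is square summable. This gives the energy estimate `inner_field_sub_le`.

The Galerkin solution is compared with the truncated exact solution, not with the exact solution
itself. Linear terms commute with truncation, so the truncation error enters only through the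
nonlinear terms, and there only its `L²` size `N^(-μ)` matters. Hence the optimal order, although
the energy norm contains a derivative. As `N^(-μ)` tends to `0`, a continuation argument
(`exists_solution_near`, applied in `IsExact.exists_isGalerkin`) gives existence up to time `T` for
large `N` together with the error bound.

Uniqueness holds because the Galerkin field is polynomial. It also shows that the estimate covers
every semidiscrete solution, and that finitely many small `N` only enlarge the constant. -/

/-! ### Differential equations near an approximate solution -/

/-- The radial retraction of a normed space onto its closed unit ball. -/
noncomputable def ballRetract {X : Type*} [NormedAddCommGroup X] [NormedSpace ℝ X] (x : X) : X :=
  (max 1 ‖x‖)⁻¹ • x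

theorem norm_ballRetract_le {X : Type*} [NormedAddCommGroup X] [NormedSpace ℝ X] (x : X) :
    ‖ballRetract x‖ ≤ 1 := by
  have h : (0 : ℝ) < max 1 ‖x‖ := lt_max_of_lt_left one_pos
  rw [ballRetract, norm_smul, norm_inv, Real.norm_of_nonneg h.le, inv_mul_le_iff₀ h, mul_one]
  exact le_max_right _ _

theorem ballRetract_of_norm_le {X : Type*} [NormedAddCommGroup X] [NormedSpace ℝ X] {x : X}
    (hx : ‖x‖ ≤ 1) : ballRetract x = x := by
  rw [ballRetract, max_eq_left hx, inv_one, one_smul]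

theorem lipschitzWith_ballRetract {X : Type*} [NormedAddCommGroup X] [NormedSpace ℝ X] :
    LipschitzWith 2 (ballRetract : X → X) := by
  apply LipschitzWith.of_dist_le_mul
  intro x y
  rw [dist_eq_norm, dist_eq_norm]
  set m := max 1 ‖x‖ with hm
  set n := max 1 ‖y‖ with hn
  have hm1 : 1 ≤ m := le_max_left _ _
  have hn1 : 1 ≤ n := le_max_left _ _
  have hmn : |m - n| ≤ ‖x - y‖ := by
    refine (abs_max_sub_max_le_max 1 ‖x‖ 1 ‖y‖).trans ?_
    simpa using abs_norm_sub_norm_le x y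
  have e : ballRetract x - ballRetract y = m⁻¹ • (x - y) + (m⁻¹ * (n - m)) • ballRetract y := by
    have h : m⁻¹ * (n - m) * n⁻¹ = m⁻¹ - n⁻¹ := by field_simp
    simp only [ballRetract, ← hm, ← hn, smul_smul, h, smul_sub, sub_smul]
    abel
  have hmi : m⁻¹ ≤ 1 := inv_le_one_of_one_le₀ hm1
  have hmi0 : 0 ≤ m⁻¹ := by positivity
  have h1 : ‖m⁻¹ • (x - y)‖ ≤ ‖x - y‖ := by
    rw [norm_smul, Real.norm_of_nonneg hmi0]
    exact mul_le_of_le_one_left (norm_nonneg _) hmi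
  have h2 : ‖(m⁻¹ * (n - m)) • ballRetract y‖ ≤ ‖x - y‖ := by
    rw [norm_smul, norm_mul, Real.norm_of_nonneg hmi0, Real.norm_eq_abs, abs_sub_comm]
    calc m⁻¹ * |m - n| * ‖ballRetract y‖ ≤ 1 * ‖x - y‖ * 1 := by
          gcongr
          exact norm_ballRetract_le y
      _ = ‖x - y‖ := by ring
  rw [e]
  refine (norm_add_le _ _).trans ?_
  simp only [NNReal.coe_ofNat]
  linarith

theorem ContDiff.exists_lipschitzOnWith_closedBall {X Y : Type*} [NormedAddCommGroup X]
    [NormedSpace ℝ X] [FiniteDimensional ℝ X] [NormedAddCommGroup Y] [NormedSpace ℝ Y]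
    {V : X → Y} (hV : ContDiff ℝ 1 V) (R : ℝ) :
    ∃ K, LipschitzOnWith K V (Metric.closedBall 0 R) := by
  have := FiniteDimensional.proper_real X
  exact hV.locallyLipschitz.locallyLipschitzOn.exists_lipschitzOnWith_of_compact
    (isCompact_closedBall 0 R)

/-- A Grönwall bound for the norm, from a one-sided estimate. -/
theorem norm_le_exp_mul_of_inner_le {X : Type*} [NormedAddCommGroup X] [InnerProductSpace ℝ X]
    {T K ε : ℝ} (hK : 0 ≤ K) (hε : 0 ≤ ε) {e e' : ℝ → X}
    (he : ∀ t ∈ Icc 0 T, HasDerivWithinAt e (e' t) (Icc 0 T) t) (h0 : e 0 = 0)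
    (hest : ∀ t ∈ Icc 0 T, inner ℝ (e t) (e' t) ≤ K * ‖e t‖ * (‖e t‖ + ε)) :
    ∀ t ∈ Icc 0 T, ‖e t‖ ≤ Real.exp (2 * K * T) * ε := by
  intro t ht
  -- Since `2K‖e‖(‖e‖ + ε) ≤ 3K(‖e‖² + ε²)`, this function is nonincreasing. Adding `ε²` absorbs the
  -- inhomogeneity and avoids differentiating the norm at zeros of `e`.
  set h : ℝ → ℝ := fun t => (‖e t‖ ^ 2 + ε ^ 2) * Real.exp (-(3 * K * t)) with hh
  have hd : ∀ t ∈ Icc 0 T, HasDerivWithinAt h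
      (2 * inner ℝ (e t) (e' t) * Real.exp (-(3 * K * t))
        + (‖e t‖ ^ 2 + ε ^ 2) * (Real.exp (-(3 * K * t)) * (-(3 * K * 1)))) (Icc 0 T) t := by
    intro t ht
    exact ((he t ht).norm_sq.add_const _).mul
      ((((hasDerivAt_id t).const_mul (3 * K)).neg.exp).hasDerivWithinAt)
  have hanti : AntitoneOn h (Icc 0 T) := by
    apply antitoneOn_of_hasDerivWithinAt_nonpos (convex_Icc 0 T)
      (fun t ht => (hd t ht).continuousWithinAt)
      (fun t ht => (hd t (interior_subset ht)).mono interior_subset)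
    intro t ht
    have h1 := hest t (interior_subset ht)
    have h2 : 2 * inner ℝ (e t) (e' t) - 3 * K * (‖e t‖ ^ 2 + ε ^ 2) ≤ 0 := by
      nlinarith [mul_nonneg hK (sq_nonneg (‖e t‖ - ε)), mul_nonneg hK (sq_nonneg ε)]
    have h3 := mul_nonpos_of_nonpos_of_nonneg h2 (Real.exp_pos (-(3 * K * t))).le
    linarith
  have hle := hanti (left_mem_Icc.2 (ht.1.trans ht.2)) ht ht.1
  simp only [hh, h0, norm_zero, mul_zero, neg_zero, Real.exp_zero, mul_one, ne_eq,
    OfNat.ofNat_ne_zero, not_false_eq_true, zero_pow, zero_add] at hle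
  rw [Real.exp_neg, ← div_eq_mul_inv, div_le_iff₀ (Real.exp_pos _)] at hle
  -- The rate `3K` for the square is relaxed to `4K`, so that the square root has the exponent
  -- `2KT`.
  have hexp : Real.exp (3 * K * t) ≤ Real.exp (2 * K * T) ^ 2 := by
    rw [← Real.exp_nat_mul]
    apply Real.exp_le_exp.2
    push_cast
    have := mul_le_mul_of_nonneg_left ht.2 hK
    have := mul_nonneg hK (ht.1.trans ht.2)
    linarith
  apply (pow_le_pow_iff_left₀ (norm_nonneg _) (by positivity) two_ne_zero).1
  rw [mul_pow]
  nlinarith [mul_le_mul_of_nonneg_left hexp (sq_nonneg ε), sq_nonneg ε]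

/-- If `Y` satisfies `Y' = V(Y)` up to an error which is controlled in a one-sided sense on the
unit ball around `Y`, there is a solution of `y' = V(y)` which stays close to `Y`. -/
theorem exists_solution_near {X : Type*} [NormedAddCommGroup X] [InnerProductSpace ℝ X]
    [FiniteDimensional ℝ X] {V : X → X} (hV : ContDiff ℝ 1 V) {T K ε : ℝ} (hT : 0 ≤ T)
    (hK : 0 ≤ K) (hε : 0 ≤ ε) {Y Y' : ℝ → X}
    (hY : ∀ t ∈ Icc 0 T, HasDerivWithinAt Y (Y' t) (Icc 0 T) t)
    (hest : ∀ t ∈ Icc 0 T, ∀ η : X, ‖η‖ ≤ 1 →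
      inner ℝ η (V (Y t + η) - Y' t) ≤ K * ‖η‖ * (‖η‖ + ε))
    (hsmall : Real.exp (2 * K * T) * ε ≤ 1) :
    ∃ y : ℝ → X, y 0 = Y 0 ∧ (∀ t ∈ Icc 0 T, HasDerivWithinAt y (V (y t)) (Icc 0 T) t) ∧
      ∀ t ∈ Icc 0 T, ‖y t - Y t‖ ≤ Real.exp (2 * K * T) * ε := by
  have hYc : ContinuousOn Y (Icc 0 T) := fun t ht => (hY t ht).continuousWithinAt
  obtain ⟨R, hR⟩ := isCompact_Icc.exists_bound_of_continuousOn hYc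
  obtain ⟨κ, hκ⟩ := hV.exists_lipschitzOnWith_closedBall (R + 1)
  have := FiniteDimensional.proper_real X
  obtain ⟨L, hL⟩ := (isCompact_closedBall (0 : X) (R + 1)).exists_bound_of_continuousOn
    hV.continuous.continuousOn
  have hmem : ∀ t ∈ Icc 0 T, ∀ x, Y t + ballRetract (x - Y t) ∈ Metric.closedBall (0 : X) (R + 1) := by
    intro t ht x
    rw [mem_closedBall_zero_iff]
    exact (norm_add_le _ _).trans (add_le_add (hR t ht) (norm_ballRetract_le _))
  have h0 : (0 : ℝ) ∈ Icc 0 T := left_mem_Icc.2 hT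
  have hL0 : 0 ≤ L := (norm_nonneg _).trans (hL _ (hmem 0 h0 0))
  -- The field is evaluated at the retraction of `x` to the unit ball around `Y t`. This makes it
  -- globally Lipschitz and bounded by `L`, so a solution exists on all of `[0, T]` within the ball
  -- of radius `LT`.
  have hpl : IsPicardLindelof (fun t x => V (Y t + ballRetract (x - Y t))) (⟨0, h0⟩ : Icc 0 T)
      (Y 0) (L.toNNReal * T.toNNReal) 0 L.toNNReal (κ * 2) := by
    refine ⟨?_, ?_, ?_, ?_⟩
    · intro t ht
      apply LipschitzWith.lipschitzOnWith
      apply LipschitzWith.of_dist_le_mul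
      intro x y
      refine (hκ.dist_le_mul _ (hmem t ht x) _ (hmem t ht y)).trans ?_
      rw [NNReal.coe_mul, mul_assoc, dist_add_left]
      gcongr
      refine (lipschitzWith_ballRetract.dist_le_mul _ _).trans ?_
      rw [dist_sub_right]
    · intro x _
      exact hV.continuous.comp_continuousOn (hYc.add
        (lipschitzWith_ballRetract.continuous.comp_continuousOn (continuousOn_const.sub hYc)))
    · intro t ht x _
      rw [Real.coe_toNNReal _ hL0]
      exact hL _ (hmem t ht x)
    · simp [hT]
  obtain ⟨y, hy0, hy⟩ := hpl.exists_eq_forall_mem_Icc_hasDerivWithinAt₀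
  simp only at hy0
  have hclose : ∀ t ∈ Icc 0 T, ‖y t - Y t‖ ≤ Real.exp (2 * K * T) * ε := by
    apply norm_le_exp_mul_of_inner_le hK hε (fun t ht => (hy t ht).sub (hY t ht)) (by simp [hy0])
    intro t ht
    set η := y t - Y t with hη
    have hm : (0 : ℝ) < max 1 ‖η‖ := lt_max_of_lt_left one_pos
    -- The one-sided estimate is known on the unit ball only. As `η` is a multiple `≥ 1` of its
    -- retraction, the estimate at the retraction, multiplied by this factor, gives the one at `η`.
    have hηr : η = (max 1 ‖η‖) • ballRetract η := by
      rw [ballRetract, smul_smul, mul_inv_cancel₀ hm.ne', one_smul]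
    have hn : ‖η‖ = max 1 ‖η‖ * ‖ballRetract η‖ := by
      conv_lhs => rw [hηr, norm_smul, Real.norm_of_nonneg hm.le]
    have hle : ‖ballRetract η‖ ≤ ‖η‖ := by
      rw [hn]
      exact le_mul_of_one_le_left (norm_nonneg _) (le_max_left _ _)
    calc inner ℝ η (V (Y t + ballRetract η) - Y' t)
        = max 1 ‖η‖ * inner ℝ (ballRetract η) (V (Y t + ballRetract η) - Y' t) := by
          conv_lhs => arg 2; rw [hηr]
          rw [real_inner_smul_left]
      _ ≤ max 1 ‖η‖ * (K * ‖ballRetract η‖ * (‖ballRetract η‖ + ε)) := by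
          gcongr
          exact hest t ht _ (norm_ballRetract_le _)
      _ = K * (max 1 ‖η‖ * ‖ballRetract η‖) * (‖ballRetract η‖ + ε) := by ring
      _ ≤ K * ‖η‖ * (‖η‖ + ε) := by
          rw [← hn]
          gcongr
  refine ⟨y, hy0, fun t ht => ?_, hclose⟩
  have := hy t ht
  -- By `hsmall` the solution never leaves the unit ball around `Y`, where the modified field is
  -- `V`.
  rwa [ballRetract_of_norm_le ((hclose t ht).trans hsmall), add_sub_cancel] at this

/-- Uniqueness for autonomous differential equations with a `C¹` right hand side. -/
theorem ode_unique_of_contDiff {X : Type*} [NormedAddCommGroup X] [NormedSpace ℝ X]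
    [FiniteDimensional ℝ X] {V : X → X} (hV : ContDiff ℝ 1 V) {T : ℝ} {y z : ℝ → X}
    (hy : ∀ t ∈ Icc 0 T, HasDerivWithinAt y (V (y t)) (Icc 0 T) t)
    (hz : ∀ t ∈ Icc 0 T, HasDerivWithinAt z (V (z t)) (Icc 0 T) t) (h0 : y 0 = z 0) :
    ∀ t ∈ Icc 0 T, y t = z t := by
  have hyc : ContinuousOn y (Icc 0 T) := fun t ht => (hy t ht).continuousWithinAt
  have hzc : ContinuousOn z (Icc 0 T) := fun t ht => (hz t ht).continuousWithinAt
  obtain ⟨R, hR⟩ := isCompact_Icc.exists_bound_of_continuousOn hyc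
  obtain ⟨R', hR'⟩ := isCompact_Icc.exists_bound_of_continuousOn hzc
  obtain ⟨κ, hκ⟩ := hV.exists_lipschitzOnWith_closedBall (max R R')
  refine ODE_solution_unique_of_mem_Icc_right (v := fun _ => V)
    (s := fun _ => Metric.closedBall 0 (max R R')) (fun _ _ => hκ) hyc ?_ ?_ hzc ?_ ?_ h0
  · intro t ht
    exact (hy t (Ico_subset_Icc_self ht)).mono_of_mem_nhdsWithin (Icc_mem_nhdsGE_of_mem ht)
  · intro t ht
    exact mem_closedBall_zero_iff.2 ((hR t (Ico_subset_Icc_self ht)).trans (le_max_left _ _))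
  · intro t ht
    exact (hz t (Ico_subset_Icc_self ht)).mono_of_mem_nhdsWithin (Icc_mem_nhdsGE_of_mem ht)
  · intro t ht
    exact mem_closedBall_zero_iff.2 ((hR' t (Ico_subset_Icc_self ht)).trans (le_max_right _ _))

/-! ### Bounds for sequences and convolutions -/

/-- `‖f‖_{ℓ¹} ≤ M` -/
def EllOneLe (f : ℤ → ℂ) (M : ℝ) : Prop := ∀ s : Finset ℤ, ∑ k ∈ s, ‖f k‖ ≤ M

/-- `‖f‖_{ℓ²} ≤ M` -/
def EllTwoLe (f : ℤ → ℂ) (M : ℝ) : Prop := 0 ≤ M ∧ ∀ s : Finset ℤ, ∑ k ∈ s, ‖f k‖ ^ 2 ≤ M ^ 2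

theorem EllOneLe.nonneg {f : ℤ → ℂ} {M : ℝ} (h : EllOneLe f M) : 0 ≤ M := by simpa using h ∅

theorem EllOneLe.mono {f : ℤ → ℂ} {M M' : ℝ} (h : EllOneLe f M) (hM : M ≤ M') : EllOneLe f M' :=
  fun s => (h s).trans hM

theorem EllTwoLe.mono {f : ℤ → ℂ} {M M' : ℝ} (h : EllTwoLe f M) (hM : M ≤ M') : EllTwoLe f M' :=
  ⟨h.1.trans hM, fun s => (h.2 s).trans (pow_le_pow_left₀ h.1 hM 2)⟩

theorem EllOneLe.of_norm_le {f g : ℤ → ℂ} {M : ℝ} (h : EllOneLe g M) (hfg : ∀ k, ‖f k‖ ≤ ‖g k‖) :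
    EllOneLe f M := fun s => (Finset.sum_le_sum fun k _ => hfg k).trans (h s)

theorem EllTwoLe.of_norm_le {f g : ℤ → ℂ} {M : ℝ} (h : EllTwoLe g M) (hfg : ∀ k, ‖f k‖ ≤ ‖g k‖) :
    EllTwoLe f M :=
  ⟨h.1, fun s => (Finset.sum_le_sum fun k _ =>
    pow_le_pow_left₀ (norm_nonneg _) (hfg k) 2).trans (h.2 s)⟩

theorem EllOneLe.add {f g : ℤ → ℂ} {M M' : ℝ} (hf : EllOneLe f M) (hg : EllOneLe g M') :
    EllOneLe (f + g) (M + M') := by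
  intro s
  refine (Finset.sum_le_sum fun k _ => norm_add_le (f k) (g k)).trans ?_
  rw [Finset.sum_add_distrib]
  exact add_le_add (hf s) (hg s)

theorem EllOneLe.ellTwoLe {f : ℤ → ℂ} {M : ℝ} (h : EllOneLe f M) : EllTwoLe f M :=
  ⟨h.nonneg, fun s => (Finset.sum_sq_le_sq_sum_of_nonneg fun k _ => norm_nonneg (f k)).trans
    (pow_le_pow_left₀ (Finset.sum_nonneg fun k _ => norm_nonneg (f k)) (h s) 2)⟩

theorem EllOneLe.summable {f : ℤ → ℂ} {M : ℝ} (h : EllOneLe f M) : Summable f :=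
  (summable_of_sum_le (fun k => norm_nonneg (f k)) h).of_norm

theorem EllTwoLe.sum_mul_le {f g : ℤ → ℂ} {M M' : ℝ} (hf : EllTwoLe f M) (hg : EllTwoLe g M')
    (s : Finset ℤ) : ∑ k ∈ s, ‖f k‖ * ‖g k‖ ≤ M * M' := by
  have h := Finset.sum_mul_sq_le_sq_mul_sq s (fun k => ‖f k‖) fun k => ‖g k‖
  apply le_of_sq_le_sq _ (mul_nonneg hf.1 hg.1)
  rw [mul_pow]
  exact h.trans (mul_le_mul (hf.2 s) (hg.2 s) (Finset.sum_nonneg fun _ _ => sq_nonneg _)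
    (sq_nonneg _))

theorem EllTwoLe.mul {f g : ℤ → ℂ} {M M' : ℝ} (hf : EllTwoLe f M) (hg : EllTwoLe g M') :
    EllOneLe (fun k => f k * g k) (M * M') := by
  intro s
  simp only [norm_mul]
  exact hf.sum_mul_le hg s

theorem EllTwoLe.add {f g : ℤ → ℂ} {M M' : ℝ} (hf : EllTwoLe f M) (hg : EllTwoLe g M') :
    EllTwoLe (f + g) (M + M') := by
  refine ⟨add_nonneg hf.1 hg.1, fun s => ?_⟩
  calc ∑ k ∈ s, ‖(f + g) k‖ ^ 2 ≤ ∑ k ∈ s, (‖f k‖ + ‖g k‖) ^ 2 :=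
        Finset.sum_le_sum fun k _ => pow_le_pow_left₀ (norm_nonneg _) (norm_add_le _ _) 2
    _ = ∑ k ∈ s, ‖f k‖ ^ 2 + 2 * ∑ k ∈ s, ‖f k‖ * ‖g k‖ + ∑ k ∈ s, ‖g k‖ ^ 2 := by
        simp only [add_sq, Finset.sum_add_distrib, Finset.mul_sum, mul_assoc]
    _ ≤ M ^ 2 + 2 * (M * M') + M' ^ 2 := by
        gcongr
        exacts [hf.2 s, hf.sum_mul_le hg s, hg.2 s]
    _ = (M + M') ^ 2 := by ring

theorem EllTwoLe.const_smul {f : ℤ → ℂ} {M : ℝ} (hf : EllTwoLe f M) (c : ℂ) :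
    EllTwoLe (c • f) (‖c‖ * M) := by
  refine ⟨mul_nonneg (norm_nonneg _) hf.1, fun s => ?_⟩
  simp only [Pi.smul_apply, smul_eq_mul, norm_mul, mul_pow, ← Finset.mul_sum]
  exact mul_le_mul_of_nonneg_left (hf.2 s) (sq_nonneg _)

theorem EllTwoLe.comp_injective {f : ℤ → ℂ} {M : ℝ} (hf : EllTwoLe f M) {σ : ℤ → ℤ}
    (hσ : Function.Injective σ) : EllTwoLe (fun k => f (σ k)) M := by
  refine ⟨hf.1, fun s => ?_⟩
  have := hf.2 (s.map ⟨σ, hσ⟩)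
  rwa [Finset.sum_map] at this

/-- The convolution of two sequences. -/
noncomputable def conv (f g : ℤ → ℂ) (k : ℤ) : ℂ := ∑' j, f j * g (k - j)

theorem EllTwoLe.mul_shift {f g : ℤ → ℂ} {M M' : ℝ} (hf : EllTwoLe f M) (hg : EllTwoLe g M')
    (k : ℤ) : EllOneLe (fun j => f j * g (k - j)) (M * M') :=
  hf.mul (hg.comp_injective sub_right_injective)

theorem norm_conv_le {f g : ℤ → ℂ} {M M' : ℝ} (hf : EllTwoLe f M) (hg : EllTwoLe g M') (k : ℤ) :
    ‖conv f g k‖ ≤ M * M' := by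
  have h := hf.mul_shift hg k
  have hs := summable_of_sum_le (fun k => norm_nonneg _) h
  exact (norm_tsum_le_tsum_norm hs).trans (hs.tsum_le_of_sum_le h)

theorem conv_comm (f g : ℤ → ℂ) : conv f g = conv g f := by
  funext k
  unfold conv
  rw [← (Equiv.subLeft k).tsum_eq fun j => g j * f (k - j)]
  refine tsum_congr fun j => ?_
  simp only [Equiv.subLeft_apply, sub_sub_cancel, mul_comm]

theorem conv_add_right {f g h : ℤ → ℂ} {A B C : ℝ} (hf : EllTwoLe f A) (hg : EllTwoLe g B)
    (hh : EllTwoLe h C) : conv f (g + h) = conv f g + conv f h := by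
  funext k
  simp only [conv, Pi.add_apply, mul_add]
  exact (hf.mul_shift hg k).summable.tsum_add (hf.mul_shift hh k).summable

theorem conv_add_left {f g h : ℤ → ℂ} {A B C : ℝ} (hf : EllTwoLe f A) (hg : EllTwoLe g B)
    (hh : EllTwoLe h C) : conv (f + g) h = conv f h + conv g h := by
  rw [conv_comm, conv_add_right hh hf hg, conv_comm h f, conv_comm h g]

/-- Young's inequality `ℓ¹ * ℓ² ⊆ ℓ²`. -/
theorem EllOneLe.conv {f g : ℤ → ℂ} {M M' : ℝ} (hf : EllOneLe f M) (hg : EllTwoLe g M') :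
    EllTwoLe (conv f g) (M * M') := by
  refine ⟨mul_nonneg hf.nonneg hg.1, fun s => ?_⟩
  -- Restricted to `s`, the convolution is a sum over `j` of the translates of `g` weighted by `f
  -- j`. The triangle inequality in a finite-dimensional Euclidean space then gives the bound.
  let v : ℤ → EuclideanSpace ℂ s := fun j => f j • WithLp.toLp 2 (fun k : s => g (k - j))
  have hv : ∀ j, ‖v j‖ ≤ ‖f j‖ * M' := by
    intro j
    rw [norm_smul]
    gcongr
    rw [EuclideanSpace.norm_eq]
    apply Real.sqrt_le_iff.2 ⟨hg.1, ?_⟩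
    have := (hg.comp_injective (sub_left_injective (b := j))).2 s
    rwa [← Finset.sum_coe_sort] at this
  have hfs := summable_of_sum_le (fun k => norm_nonneg (f k)) hf
  have hvs : Summable fun j => ‖v j‖ :=
    Summable.of_nonneg_of_le (fun j => norm_nonneg _) hv (hfs.mul_right M')
  have hle : ‖∑' j, v j‖ ≤ M * M' := by
    refine (norm_tsum_le_tsum_norm hvs).trans ((hvs.tsum_le_tsum hv (hfs.mul_right M')).trans ?_)
    rw [tsum_mul_right]
    exact mul_le_mul_of_nonneg_right (hfs.tsum_le_of_sum_le hf) hg.1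
  have happ : ∀ k : s, (∑' j, v j) k = _root_.conv f g k := by
    intro k
    have := (EuclideanSpace.proj k : EuclideanSpace ℂ s →L[ℂ] ℂ).map_tsum hvs.of_norm
    simpa [v, _root_.conv] using this
  have h2 := pow_le_pow_left₀ (norm_nonneg _) hle 2
  rw [EuclideanSpace.norm_sq_eq] at h2
  simp only [happ] at h2
  rwa [Finset.sum_coe_sort s fun k => ‖_root_.conv f g k‖ ^ 2] at h2

/-- Bilinear expansion, with commutativity used to put in front the factors `p`, `q`, `a` that may
be summable. -/
theorem conv_add_add_sub {p q a b : ℤ → ℂ} {A B C D : ℝ} (hp : EllTwoLe p A) (hq : EllTwoLe q B)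
    (ha : EllTwoLe a C) (hb : EllTwoLe b D) :
    conv (p + a) (q + b) - conv p q = conv p b + conv q a + conv a b := by
  rw [conv_add_left hp ha (hq.add hb), conv_add_right hp hq hb, conv_add_right ha hq hb,
    conv_comm q a]
  abel

/-- Each of the three products in the expansion has one factor bounded in `ℓ¹` and one small in
`ℓ²`, so Young's inequality applies. No `ℓ¹` bound for `b` is needed: in the application `b`
perturbs, in one of the products, the unknown that the energy controls in `L²` only. -/
theorem ellTwoLe_conv_sub {p q a b : ℤ → ℂ} {M ε : ℝ} (hp : EllOneLe p M) (hq : EllOneLe q M)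
    (ha : EllOneLe a M) (ha' : EllTwoLe a ε) (hb : EllTwoLe b ε) :
    EllTwoLe (conv (p + a) (q + b) - conv p q) (3 * M * ε) := by
  rw [conv_add_add_sub hp.ellTwoLe hq.ellTwoLe ha' hb]
  refine (((hp.conv hb).add (hq.conv ha')).add (ha.conv hb)).mono ?_
  linarith

/-- The substitute when neither perturbation is controlled in `ℓ¹`: by Cauchy–Schwarz a convolution
of two `ℓ²` sequences is still bounded. -/
theorem norm_conv_sub_le {p q a b : ℤ → ℂ} {M ε : ℝ} (hp : EllTwoLe p M) (hq : EllTwoLe q M)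
    (ha : EllTwoLe a M) (ha' : EllTwoLe a ε) (hb : EllTwoLe b ε) (k : ℤ) :
    ‖conv (p + a) (q + b) k - conv p q k‖ ≤ 3 * M * ε := by
  have h := congrFun (conv_add_add_sub hp hq ha' hb) k
  simp only [Pi.sub_apply, Pi.add_apply] at h
  rw [h]
  have h1 := norm_conv_le hp hb k
  have h2 := norm_conv_le hq ha' k
  have h3 := norm_conv_le ha hb k
  have := norm_add₃_le (a := conv p b k) (b := conv q a k) (c := conv a b k)
  linarith

/-- The bound is written as `S ^ 2` because `S` serves as the `ℓ²` norm of `(1 + k²)^(-1/2)`, both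
in the embedding into `ℓ¹` and in the bound for the symbol `B`. -/
theorem exists_sum_one_add_sq_inv_le :
    ∃ S : ℝ, 0 ≤ S ∧ ∀ s : Finset ℤ, ∑ k ∈ s, (1 + (k : ℝ) ^ 2)⁻¹ ≤ S ^ 2 := by
  have h : Summable fun k : ℤ => (1 + (k : ℝ) ^ 2)⁻¹ := by
    have h1 : Summable fun k : ℤ => 1 / (k : ℝ) ^ 2 := Real.summable_one_div_int_pow.2 one_lt_two
    refine ((h1.mul_left 1).add (hasSum_ite_eq (0 : ℤ) (1 : ℝ)).summable).of_nonneg_of_le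
      (fun k => by positivity) fun k => ?_
    by_cases hk : k = 0
    · simp [hk]
    · have : 0 < (k : ℝ) ^ 2 := by positivity
      simp only [hk, if_false, one_mul, add_zero, one_div]
      gcongr
      linarith
  refine ⟨Real.sqrt (∑' k : ℤ, (1 + (k : ℝ) ^ 2)⁻¹), Real.sqrt_nonneg _, fun s => ?_⟩
  rw [Real.sq_sqrt (tsum_nonneg fun k => by positivity)]
  exact h.sum_le_tsum s fun k _ => by positivity

/-- The embedding of a weighted `ℓ²` space, with a weight of the size of `(1 + k²)^{1/2}`, into
`ℓ¹`. -/
theorem EllTwoLe.ellOneLe_of_weight {S : ℝ} (hS0 : 0 ≤ S)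
    (hS : ∀ s : Finset ℤ, ∑ k ∈ s, (1 + (k : ℝ) ^ 2)⁻¹ ≤ S ^ 2) {w : ℤ → ℝ} {C M : ℝ} (hC : 0 ≤ C)
    (hw : ∀ k : ℤ, 1 + (k : ℝ) ^ 2 ≤ C ^ 2 * w k ^ 2) {f : ℤ → ℂ}
    (hf : EllTwoLe (fun k => w k * f k) M) : EllOneLe f (C * S * M) := by
  -- Cauchy–Schwarz for `f = w⁻¹ · (w f)`, with `w⁻¹` dominated by `C (1 + k²)^(-1/2)`.
  have h1 : EllTwoLe (fun k : ℤ => (Real.sqrt (1 + (k : ℝ) ^ 2)⁻¹ : ℂ)) S := by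
    refine ⟨hS0, fun s => ?_⟩
    convert hS s using 2 with k
    rw [Complex.norm_real, Real.norm_of_nonneg (Real.sqrt_nonneg _), Real.sq_sqrt (by positivity)]
  have h2 := ((h1.const_smul C).mul hf).mono (M' := C * S * M)
    (by rw [Complex.norm_real, Real.norm_of_nonneg hC])
  refine h2.of_norm_le fun k => ?_
  have hk : (0 : ℝ) < 1 + (k : ℝ) ^ 2 := by positivity
  simp only [Pi.smul_apply, smul_eq_mul, norm_mul, Complex.norm_real, Real.norm_eq_abs,
    abs_of_nonneg hC, abs_of_nonneg (Real.sqrt_nonneg _)]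
  rw [← mul_assoc]
  apply le_mul_of_one_le_left (norm_nonneg _)
  apply (one_le_sq_iff₀ (by positivity)).1
  rw [mul_pow, mul_pow, Real.sq_sqrt (by positivity), sq_abs, mul_right_comm, ← div_eq_mul_inv,
    one_le_div hk]
  exact hw k

theorem EllTwoLe.of_weight {w : ℤ → ℝ} {C M : ℝ} (hC : 0 ≤ C)
    (hw : ∀ k : ℤ, 1 + (k : ℝ) ^ 2 ≤ C ^ 2 * w k ^ 2) {f : ℤ → ℂ}
    (hf : EllTwoLe (fun k => w k * f k) M) : EllTwoLe f (C * M) := by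
  have h2 := (hf.const_smul C).mono (M' := C * M) (by rw [Complex.norm_real, Real.norm_of_nonneg hC])
  refine h2.of_norm_le fun k => ?_
  simp only [Pi.smul_apply, smul_eq_mul, norm_mul, Complex.norm_real, Real.norm_eq_abs,
    abs_of_nonneg hC]
  rw [← mul_assoc]
  apply le_mul_of_one_le_left (norm_nonneg _)
  apply (one_le_sq_iff₀ (by positivity)).1
  rw [mul_pow, sq_abs]
  nlinarith [hw k, sq_nonneg (k : ℝ)]

/-! ### Galerkin approximation of dispersive systems in Fourier space -/

theorem hasDerivWithinAt_piLp_two {ι : Type*} [Fintype ι] {y : ℝ → PiLp 2 (fun _ : ι => ℂ)}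
    {y' : PiLp 2 (fun _ : ι => ℂ)} {s : Set ℝ} {t : ℝ} :
    HasDerivWithinAt y y' s t ↔ ∀ i, HasDerivWithinAt (fun τ => y τ i) (y' i) s t := by
  rw [hasDerivWithinAt_iff_hasFDerivWithinAt, hasFDerivWithinAt_piLp]
  refine forall_congr' fun i => ?_
  rw [hasDerivWithinAt_iff_hasFDerivWithinAt]
  convert! Iff.rfl using 2

/-- Symbols and coefficients of the system
`p' = -i (α q + A F(p, q))`, `q' = -i (W² α p + B G(p, q))` for sequences `p`, `q` of Fourier
coefficients, with quadratic nonlinearities `F = f₁ p * p + f₂ p * q`,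
`G = g₁ p * q + g₂ q * q`. -/
structure DispersiveSystem where
  α : ℤ → ℝ
  W : ℤ → ℝ
  A : ℤ → ℝ
  B : ℤ → ℝ
  f₁ : ℝ
  f₂ : ℝ
  g₁ : ℝ
  g₂ : ℝ

namespace DispersiveSystem

variable (σ : DispersiveSystem)

noncomputable def F (p q : ℤ → ℂ) (k : ℤ) : ℂ := σ.f₁ * conv p p k + σ.f₂ * conv p q k

noncomputable def G (p q : ℤ → ℂ) (k : ℤ) : ℂ := σ.g₁ * conv p q k + σ.g₂ * conv q q k

noncomputable def rhsP (p q : ℤ → ℂ) (k : ℤ) : ℂ :=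
  -Complex.I * (σ.α k * q k + σ.A k * σ.F p q k)

noncomputable def rhsQ (p q : ℤ → ℂ) (k : ℤ) : ℂ :=
  -Complex.I * (σ.W k ^ 2 * σ.α k * p k + σ.B k * σ.G p q k)

/-- The weight `W` is positive and of size at least `(1 + k²)^{1/2}`, up to a constant, `W A` is
bounded and `B` is square summable. -/
structure Bounded (C : ℝ) : Prop where
  one_le : 1 ≤ C
  W_pos : ∀ k, 0 < σ.W k
  le_W : ∀ k : ℤ, 1 + (k : ℝ) ^ 2 ≤ C ^ 2 * σ.W k ^ 2
  WA_le : ∀ k, |σ.W k * σ.A k| ≤ C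
  B_le : EllTwoLe (fun k => (σ.B k : ℂ)) C

/-- The symbols of the operators are odd, the weight is even. -/
structure Symmetric : Prop where
  α_neg : ∀ k, σ.α (-k) = -σ.α k
  W_neg : ∀ k, σ.W (-k) = σ.W k
  A_neg : ∀ k, σ.A (-k) = -σ.A k
  B_neg : ∀ k, σ.B (-k) = -σ.B k

/-- Solutions of the system of ordinary differential equations for all Fourier coefficients. -/
def IsExact (T : ℝ) (p q : ℝ → ℤ → ℂ) : Prop :=
  ∀ t ∈ Icc 0 T, ∀ k, HasDerivWithinAt (fun s => p s k) (σ.rhsP (p t) (q t) k) (Icc 0 T) t ∧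
    HasDerivWithinAt (fun s => q s k) (σ.rhsQ (p t) (q t) k) (Icc 0 T) t

/-- Solutions of the Galerkin system, with Fourier modes `|k| ≤ N`. -/
structure IsGalerkin (T : ℝ) (N : ℕ) (p q : ℝ → ℤ → ℂ) : Prop where
  p_eq_zero : ∀ t ∈ Icc 0 T, ∀ k ∉ Finset.Icc (-(N : ℤ)) N, p t k = 0
  q_eq_zero : ∀ t ∈ Icc 0 T, ∀ k ∉ Finset.Icc (-(N : ℤ)) N, q t k = 0
  deriv_p : ∀ t ∈ Icc 0 T, ∀ k ∈ Finset.Icc (-(N : ℤ)) N,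
    HasDerivWithinAt (fun s => p s k) (σ.rhsP (p t) (q t) k) (Icc 0 T) t
  deriv_q : ∀ t ∈ Icc 0 T, ∀ k ∈ Finset.Icc (-(N : ℤ)) N,
    HasDerivWithinAt (fun s => q s k) (σ.rhsQ (p t) (q t) k) (Icc 0 T) t

end DispersiveSystem

/-- The truncation of a sequence to the modes `|k| ≤ N`. -/
noncomputable def lowPass (N : ℕ) (f : ℤ → ℂ) (k : ℤ) : ℂ := if k ∈ Finset.Icc (-(N : ℤ)) N then f k else 0

theorem norm_lowPass_sub_le (N : ℕ) (f : ℤ → ℂ) (k : ℤ) : ‖(lowPass N f - f) k‖ ≤ ‖f k‖ := by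
  by_cases h : k ∈ Finset.Icc (-(N : ℤ)) N <;> simp only [lowPass, Pi.sub_apply, h, if_true, if_false]
  · simp
  · simp

/-! ### The Galerkin system on a finite-dimensional phase space -/

namespace DispersiveSystem

variable (σ : DispersiveSystem) (N : ℕ)

/-- The phase space of the Galerkin system, with coordinates `W p` and `q`. -/
abbrev Phase : Type :=
  PiLp 2 (fun _ : Finset.Icc (-(N : ℤ)) (N : ℤ) ⊕ Finset.Icc (-(N : ℤ)) (N : ℤ) => ℂ)

/-- Truncation to `|k| ≤ N` is built in. With the weight `W` on the first component, the Euclidean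
norm of the phase space is the energy norm. -/
noncomputable def toPhase (p q : ℤ → ℂ) : Phase N :=
  WithLp.toLp 2 (Sum.elim (fun k => σ.W k * p k) fun k => q k)

variable {N}

noncomputable def weightedP (x : Phase N) (k : ℤ) : ℂ :=
  if h : k ∈ Finset.Icc (-(N : ℤ)) (N : ℤ) then x (Sum.inl ⟨k, h⟩) else 0

noncomputable def coordP (x : Phase N) (k : ℤ) : ℂ := (σ.W k : ℂ)⁻¹ * weightedP x k

noncomputable def coordQ (x : Phase N) (k : ℤ) : ℂ :=
  if h : k ∈ Finset.Icc (-(N : ℤ)) (N : ℤ) then x (Sum.inr ⟨k, h⟩) else 0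

/-- The Galerkin system as a vector field on the phase space. -/
noncomputable def field (x : Phase N) : Phase N :=
  σ.toPhase N (σ.rhsP (σ.coordP x) (coordQ x)) (σ.rhsQ (σ.coordP x) (coordQ x))

theorem weightedP_add (x y : Phase N) : weightedP (x + y) = weightedP x + weightedP y := by
  funext k
  by_cases h : k ∈ Finset.Icc (-(N : ℤ)) (N : ℤ) <;>
    simp only [weightedP, h, dite_true, dite_false, Pi.add_apply, PiLp.add_apply, add_zero]

theorem coordP_add (x y : Phase N) : σ.coordP (x + y) = σ.coordP x + σ.coordP y := by
  funext k
  simp only [coordP, weightedP_add, Pi.add_apply, mul_add]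

theorem coordQ_add (x y : Phase N) : coordQ (x + y) = coordQ x + coordQ y := by
  funext k
  by_cases h : k ∈ Finset.Icc (-(N : ℤ)) (N : ℤ) <;>
    simp only [coordQ, h, dite_true, dite_false, Pi.add_apply, PiLp.add_apply, add_zero]

variable {σ} in
theorem coordP_toPhase (hW : ∀ k, 0 < σ.W k) (p q : ℤ → ℂ) :
    σ.coordP (σ.toPhase N p q) = lowPass N p := by
  funext k
  have hk : (σ.W k : ℂ) ≠ 0 := Complex.ofReal_ne_zero.2 (hW k).ne'
  by_cases h : k ∈ Finset.Icc (-(N : ℤ)) (N : ℤ)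
  · simp only [coordP, weightedP, toPhase, h, dite_true, lowPass, if_true, Sum.elim_inl]
    rw [inv_mul_cancel_left₀ hk]
  · simp only [coordP, weightedP, h, dite_false, lowPass, if_false, mul_zero]

theorem coordQ_toPhase (p q : ℤ → ℂ) : coordQ (σ.toPhase N p q) = lowPass N q := by
  funext k
  by_cases h : k ∈ Finset.Icc (-(N : ℤ)) (N : ℤ)
  · simp only [coordQ, toPhase, h, dite_true, lowPass, if_true, Sum.elim_inr]
  · simp only [coordQ, h, dite_false, lowPass, if_false]

theorem ellTwoLe_of_support {f : ℤ → ℂ} {M : ℝ} (hM : 0 ≤ M) (s : Finset ℤ)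
    (hs : ∀ k ∉ s, f k = 0) (h : ∑ k ∈ s, ‖f k‖ ^ 2 ≤ M ^ 2) : EllTwoLe f M := by
  refine ⟨hM, fun r => le_trans ?_ h⟩
  calc ∑ k ∈ r, ‖f k‖ ^ 2 ≤ ∑ k ∈ r ∪ s, ‖f k‖ ^ 2 :=
        Finset.sum_le_sum_of_subset_of_nonneg Finset.subset_union_left fun _ _ _ => sq_nonneg _
    _ = ∑ k ∈ s, ‖f k‖ ^ 2 := by
        symm
        apply Finset.sum_subset Finset.subset_union_right
        intro k _ hk
        simp [hs k hk]

theorem sum_norm_sq_phase (x : Phase N) :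
    ∑ k ∈ Finset.Icc (-(N : ℤ)) N, ‖weightedP x k‖ ^ 2
      + ∑ k ∈ Finset.Icc (-(N : ℤ)) N, ‖coordQ x k‖ ^ 2 = ‖x‖ ^ 2 := by
  rw [PiLp.norm_sq_eq_of_L2, Fintype.sum_sum_type, ← Finset.sum_coe_sort _ fun k => ‖weightedP x k‖ ^ 2,
    ← Finset.sum_coe_sort _ fun k => ‖coordQ x k‖ ^ 2]
  congr 1 <;> refine Finset.sum_congr rfl fun k _ => ?_
  · simp only [weightedP, k.2, dite_true]
  · simp only [coordQ, k.2, dite_true]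

theorem ellTwoLe_weightedP (x : Phase N) : EllTwoLe (weightedP x) ‖x‖ := by
  refine ellTwoLe_of_support (norm_nonneg _) (Finset.Icc (-(N : ℤ)) N) (fun k hk => ?_) ?_
  · simp only [weightedP, hk, dite_false]
  · rw [← sum_norm_sq_phase]
    exact le_add_of_nonneg_right (Finset.sum_nonneg fun _ _ => sq_nonneg _)

theorem ellTwoLe_coordQ (x : Phase N) : EllTwoLe (coordQ x) ‖x‖ := by
  refine ellTwoLe_of_support (norm_nonneg _) (Finset.Icc (-(N : ℤ)) N) (fun k hk => ?_) ?_
  · simp only [coordQ, hk, dite_false]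
  · rw [← sum_norm_sq_phase]
    exact le_add_of_nonneg_left (Finset.sum_nonneg fun _ _ => sq_nonneg _)

theorem inner_toPhase (x : Phase N) (f g : ℤ → ℂ) :
    inner ℝ x (σ.toPhase N f g) = ∑ k ∈ Finset.Icc (-(N : ℤ)) N,
      ((σ.W k * f k * conj (weightedP x k)).re + (g k * conj (coordQ x k)).re) := by
  rw [PiLp.inner_apply, Fintype.sum_sum_type, Finset.sum_add_distrib,
    ← Finset.sum_coe_sort _ fun k => (σ.W k * f k * conj (weightedP x k)).re,
    ← Finset.sum_coe_sort _ fun k => (g k * conj (coordQ x k)).re]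
  congr 1 <;> refine Finset.sum_congr rfl fun k _ => ?_
  · simp only [Complex.inner, weightedP, k.2, dite_true, toPhase, Sum.elim_inl]
  · simp only [Complex.inner, coordQ, k.2, dite_true, toPhase, Sum.elim_inr]

theorem toPhase_sub (p q p' q' : ℤ → ℂ) :
    σ.toPhase N p q - σ.toPhase N p' q' = σ.toPhase N (p - p') (q - q') := by
  ext i
  rcases i with k | k <;> simp [toPhase, mul_sub]

theorem contDiff_weightedP (k : ℤ) : ContDiff ℝ 1 fun x : Phase N => weightedP x k := by
  by_cases h : k ∈ Finset.Icc (-(N : ℤ)) (N : ℤ)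
  · simp only [weightedP, h, dite_true]
    exact (contDiff_piLp 2).1 contDiff_id _
  · simp only [weightedP, h, dite_false]
    exact contDiff_const

theorem contDiff_coordP (k : ℤ) : ContDiff ℝ 1 fun x : Phase N => σ.coordP x k :=
  contDiff_const.mul (contDiff_weightedP k)

theorem contDiff_coordQ (k : ℤ) : ContDiff ℝ 1 fun x : Phase N => coordQ x k := by
  by_cases h : k ∈ Finset.Icc (-(N : ℤ)) (N : ℤ)
  · simp only [coordQ, h, dite_true]
    exact (contDiff_piLp 2).1 contDiff_id _
  · simp only [coordQ, h, dite_false]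
    exact contDiff_const

/-- Finite support of one factor reduces the series to a finite sum of products. -/
theorem contDiff_conv {X : Type*} [NormedAddCommGroup X] [NormedSpace ℝ X] {f g : X → ℤ → ℂ}
    (s : Finset ℤ) (hs : ∀ x, ∀ k ∉ s, f x k = 0) (hf : ∀ k, ContDiff ℝ 1 fun x => f x k)
    (hg : ∀ k, ContDiff ℝ 1 fun x => g x k) (k : ℤ) :
    ContDiff ℝ 1 fun x => conv (f x) (g x) k := by
  have : (fun x => conv (f x) (g x) k) = fun x => ∑ j ∈ s, f x j * g x (k - j) := by
    funext x
    exact tsum_eq_sum fun j hj => by rw [hs x j hj, zero_mul]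
  rw [this]
  exact ContDiff.sum fun j _ => (hf j).mul (hg _)

/-- The field is a quadratic polynomial in finitely many coordinates. Smoothness yields the local
Lipschitz bounds behind existence and uniqueness. -/
theorem contDiff_field : ContDiff ℝ 1 (σ.field : Phase N → Phase N) := by
  have hP : ∀ x : Phase N, ∀ k ∉ Finset.Icc (-(N : ℤ)) N, σ.coordP x k = 0 := by
    intro x k hk
    simp only [coordP, weightedP, hk, dite_false, mul_zero]
  have hQ : ∀ x : Phase N, ∀ k ∉ Finset.Icc (-(N : ℤ)) N, coordQ x k = 0 := by
    intro x k hk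
    simp only [coordQ, hk, dite_false]
  have hPP := contDiff_conv _ hP σ.contDiff_coordP σ.contDiff_coordP
  have hPQ := contDiff_conv _ hP σ.contDiff_coordP contDiff_coordQ
  have hQQ := contDiff_conv (g := fun x : Phase N => coordQ x) _ hQ contDiff_coordQ contDiff_coordQ
  rw [contDiff_piLp]
  rintro (k | k)
  · simp only [field, toPhase, Sum.elim_inl, rhsP, F]
    exact contDiff_const.mul (contDiff_const.mul ((contDiff_const.mul (contDiff_coordQ _)).add
      (contDiff_const.mul ((contDiff_const.mul (hPP _)).add (contDiff_const.mul (hPQ _))))))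
  · simp only [field, toPhase, Sum.elim_inr, rhsQ, G]
    exact contDiff_const.mul ((contDiff_const.mul (σ.contDiff_coordP _)).add
      (contDiff_const.mul ((contDiff_const.mul (hPQ _)).add (contDiff_const.mul (hQQ _)))))

variable {σ}

/-- The truncated exact solution plays the role of the approximate solution `Y`. Its derivative is
the truncated right-hand side at the full `(p, q)`, whereas `field` evaluates it at the truncation;
on the modes kept, the two differ in the nonlinear terms only. -/
theorem IsExact.hasDerivWithinAt_toPhase {T : ℝ} {p q : ℝ → ℤ → ℂ} (h : σ.IsExact T p q) (N : ℕ) :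
    ∀ t ∈ Icc 0 T, HasDerivWithinAt (fun s => σ.toPhase N (p s) (q s))
      (σ.toPhase N (σ.rhsP (p t) (q t)) (σ.rhsQ (p t) (q t))) (Icc 0 T) t := by
  intro t ht
  rw [hasDerivWithinAt_piLp_two]
  rintro (k | k)
  · exact (h t ht k).1.const_mul (σ.W k : ℂ)
  · exact (h t ht k).2

theorem lowPass_eq_self {f : ℤ → ℂ} (h : ∀ k ∉ Finset.Icc (-(N : ℤ)) N, f k = 0) :
    lowPass N f = f := by
  funext k
  by_cases hk : k ∈ Finset.Icc (-(N : ℤ)) N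
  · simp only [lowPass, hk, if_true]
  · simp only [lowPass, hk, if_false, h k hk]

theorem IsGalerkin.hasDerivWithinAt_toPhase {T : ℝ} {p q : ℝ → ℤ → ℂ} (hW : ∀ k, 0 < σ.W k)
    (h : σ.IsGalerkin T N p q) :
    ∀ t ∈ Icc 0 T, HasDerivWithinAt (fun s => σ.toPhase N (p s) (q s))
      (σ.field (σ.toPhase N (p t) (q t))) (Icc 0 T) t := by
  intro t ht
  rw [field, coordP_toPhase hW, coordQ_toPhase, lowPass_eq_self (h.p_eq_zero t ht),
    lowPass_eq_self (h.q_eq_zero t ht), hasDerivWithinAt_piLp_two]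
  rintro (k | k)
  · exact (h.deriv_p t ht k k.2).const_mul (σ.W k : ℂ)
  · exact h.deriv_q t ht k k.2

theorem isGalerkin_of_hasDerivWithinAt {T : ℝ} {y : ℝ → Phase N} (hW : ∀ k, 0 < σ.W k)
    (h : ∀ t ∈ Icc 0 T, HasDerivWithinAt y (σ.field (y t)) (Icc 0 T) t) :
    σ.IsGalerkin T N (fun t => σ.coordP (y t)) (fun t => coordQ (y t)) := by
  refine ⟨fun t _ k hk => ?_, fun t _ k hk => ?_, fun t ht k hk => ?_, fun t ht k hk => ?_⟩
  · simp only [coordP, weightedP, hk, dite_false, mul_zero]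
  · simp only [coordQ, hk, dite_false]
  · have h1 := (hasDerivWithinAt_piLp_two.1 (h t ht) (Sum.inl ⟨k, hk⟩)).const_mul (σ.W k : ℂ)⁻¹
    have hk' : (σ.W k : ℂ) ≠ 0 := Complex.ofReal_ne_zero.2 (hW k).ne'
    simp only [field, toPhase, Sum.elim_inl, inv_mul_cancel_left₀ hk'] at h1
    simpa only [coordP, weightedP, hk, dite_true] using h1
  · have h1 := hasDerivWithinAt_piLp_two.1 (h t ht) (Sum.inr ⟨k, hk⟩)
    simp only [field, toPhase, Sum.elim_inr] at h1
    simpa only [coordQ, hk, dite_true] using h1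

/-- Uniqueness for the Galerkin system. -/
theorem IsGalerkin.unique {T : ℝ} {p q p' q' : ℝ → ℤ → ℂ} (hW : ∀ k, 0 < σ.W k)
    (h : σ.IsGalerkin T N p q) (h' : σ.IsGalerkin T N p' q') (hp : p 0 = p' 0) (hq : q 0 = q' 0) :
    ∀ t ∈ Icc 0 T, p t = p' t ∧ q t = q' t := by
  intro t ht
  have := ode_unique_of_contDiff σ.contDiff_field (h.hasDerivWithinAt_toPhase hW)
    (h'.hasDerivWithinAt_toPhase hW) (by simp only [hp, hq]) t ht
  constructor
  · have h1 := congrArg σ.coordP this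
    rwa [coordP_toPhase hW, coordP_toPhase hW, lowPass_eq_self (h.p_eq_zero t ht),
      lowPass_eq_self (h'.p_eq_zero t ht)] at h1
  · have h1 := congrArg coordQ this
    rwa [coordQ_toPhase, coordQ_toPhase, lowPass_eq_self (h.q_eq_zero t ht),
      lowPass_eq_self (h'.q_eq_zero t ht)] at h1

/-- Sequences fixed by `f ↦ conj (f (-·))` are those of real functions. The substitution `j ↦ -j`
shows that this involution respects convolution. -/
theorem conv_conj_neg (f g : ℤ → ℂ) (k : ℤ) :
    conv (fun j => conj (f (-j))) (fun j => conj (g (-j))) k = conj (conv f g (-k)) := by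
  unfold conv
  rw [Complex.conj_tsum, ← (Equiv.neg ℤ).tsum_eq fun j => conj (f j * g (-k - j))]
  refine tsum_congr fun j => ?_
  rw [map_mul, Equiv.neg_apply]
  simp only
  rw [show -(k - j) = -k - -j by ring]

/-- The symbols are odd and real and are multiplied by `-i`, so each operator commutes with the
involution: the equations have real coefficients in physical space. -/
theorem IsGalerkin.conj_neg {T : ℝ} {p q : ℝ → ℤ → ℂ} (hσ : σ.Symmetric)
    (h : σ.IsGalerkin T N p q) :
    σ.IsGalerkin T N (fun t k => conj (p t (-k))) (fun t k => conj (q t (-k))) := by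
  have hneg : ∀ k, -k ∈ Finset.Icc (-(N : ℤ)) N ↔ k ∈ Finset.Icc (-(N : ℤ)) N := by
    intro k
    simp only [Finset.mem_Icc]
    omega
  refine ⟨fun t ht k hk => ?_, fun t ht k hk => ?_, fun t ht k hk => ?_, fun t ht k hk => ?_⟩
  · rw [h.p_eq_zero t ht (-k) (by rwa [hneg]), map_zero]
  · rw [h.q_eq_zero t ht (-k) (by rwa [hneg]), map_zero]
  · have key : σ.rhsP (fun k => conj (p t (-k))) (fun k => conj (q t (-k))) k
        = conj (σ.rhsP (p t) (q t) (-k)) := by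
      simp only [rhsP, F, conv_conj_neg, map_mul, map_add, map_neg,
        Complex.conj_I, Complex.conj_ofReal, hσ.α_neg, hσ.A_neg, Complex.ofReal_neg]
      ring
    rw [key]
    exact (h.deriv_p t ht (-k) ((hneg k).2 hk)).star
  · have key : σ.rhsQ (fun k => conj (p t (-k))) (fun k => conj (q t (-k))) k
        = conj (σ.rhsQ (p t) (q t) (-k)) := by
      simp only [rhsQ, G, conv_conj_neg, map_mul, map_add, map_neg, map_pow,
        Complex.conj_I, Complex.conj_ofReal, hσ.α_neg, hσ.B_neg, hσ.W_neg, Complex.ofReal_neg]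
      ring
    rw [key]
    exact (h.deriv_q t ht (-k) ((hneg k).2 hk)).star

/-- Solutions of the Galerkin system with initial values that are Fourier coefficients of real
functions remain such. -/
theorem IsGalerkin.conj_eq {T : ℝ} {p q : ℝ → ℤ → ℂ} (hW : ∀ k, 0 < σ.W k) (hσ : σ.Symmetric)
    (h : σ.IsGalerkin T N p q) (hp : ∀ k, conj (p 0 (-k)) = p 0 k)
    (hq : ∀ k, conj (q 0 (-k)) = q 0 k) :
    ∀ t ∈ Icc 0 T, (∀ k, conj (p t (-k)) = p t k) ∧ ∀ k, conj (q t (-k)) = q t k := by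
  intro t ht
  -- The reflected solution has the same initial values, so uniqueness identifies it with the
  -- original one.
  have := (h.conj_neg hσ).unique hW h (funext hp) (funext hq) t ht
  exact ⟨congrFun this.1, congrFun this.2⟩

end DispersiveSystem

/-! ### Energy estimate and existence of the Galerkin approximation -/

namespace DispersiveSystem

variable {σ : DispersiveSystem} {N : ℕ}

/-- Both products in `F` contain `p`, and the perturbation `a` of `p` is bounded in `ℓ¹`; hence an
`ℓ²` bound, to be paired with the bounded symbol `W A`. -/
theorem ellTwoLe_F_sub {p q a b : ℤ → ℂ} {M ε : ℝ} (hp : EllOneLe p M) (hq : EllOneLe q M)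
    (ha : EllOneLe a M) (ha' : EllTwoLe a ε) (hb : EllTwoLe b ε) :
    EllTwoLe (σ.F (p + a) (q + b) - σ.F p q) ((|σ.f₁| + |σ.f₂|) * (3 * M * ε)) := by
  have h1 := (ellTwoLe_conv_sub hp hp ha ha' ha').const_smul (σ.f₁ : ℂ)
  have h2 := (ellTwoLe_conv_sub hp hq ha ha' hb).const_smul (σ.f₂ : ℂ)
  convert h1.add h2 using 1
  · funext k
    simp only [F, Pi.sub_apply, Pi.add_apply, Pi.smul_apply, smul_eq_mul]
    ring
  · simp only [Complex.norm_real, Real.norm_eq_abs]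
    ring

/-- `G` contains `q * q`, where the perturbation `b` has no `ℓ¹` bound, so only a uniform estimate
is available. It suffices because the symbol `B` is square summable. -/
theorem norm_G_sub_le {p q a b : ℤ → ℂ} {M ε : ℝ} (hp : EllTwoLe p M) (hq : EllTwoLe q M)
    (ha : EllTwoLe a M) (hb : EllTwoLe b M) (ha' : EllTwoLe a ε) (hb' : EllTwoLe b ε) (k : ℤ) :
    ‖σ.G (p + a) (q + b) k - σ.G p q k‖ ≤ (|σ.g₁| + |σ.g₂|) * (3 * M * ε) := by
  have h1 := norm_conv_sub_le hp hq ha ha' hb' k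
  have h2 := norm_conv_sub_le hq hq hb hb' hb' k
  have e : σ.G (p + a) (q + b) k - σ.G p q k = σ.g₁ * (conv (p + a) (q + b) k - conv p q k)
      + σ.g₂ * (conv (q + b) (q + b) k - conv q q k) := by
    simp only [G]
    ring
  rw [e]
  refine (norm_add_le _ _).trans ?_
  rw [norm_mul, norm_mul, Complex.norm_real, Complex.norm_real, Real.norm_eq_abs, Real.norm_eq_abs,
    add_mul]
  gcongr

/-- The energy identity: the linear part of the system is skew-adjoint on the phase space. -/
theorem inner_field_sub_le {C : ℝ} (hσ : σ.Bounded C) (p q : ℤ → ℂ) (η : Phase N) {D E : ℝ}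
    (hF : EllTwoLe (σ.F (σ.coordP (σ.toPhase N p q + η)) (coordQ (σ.toPhase N p q + η))
      - σ.F p q) D)
    (hG : ∀ k, ‖σ.G (σ.coordP (σ.toPhase N p q + η)) (coordQ (σ.toPhase N p q + η)) k
      - σ.G p q k‖ ≤ E) :
    inner ℝ η (σ.field (σ.toPhase N p q + η) - σ.toPhase N (σ.rhsP p q) (σ.rhsQ p q))
      ≤ C * ‖η‖ * (D + E) := by
  rw [field, toPhase_sub, inner_toPhase]
  set P := σ.coordP (σ.toPhase N p q + η) with hP
  set Q := coordQ (σ.toPhase N p q + η) with hQ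
  have hC : 0 ≤ C := zero_le_one.trans hσ.one_le
  have hE : 0 ≤ E := (norm_nonneg _).trans (hG 0)
  have hterm : ∀ k ∈ Finset.Icc (-(N : ℤ)) N,
      (σ.W k * (σ.rhsP P Q - σ.rhsP p q) k * conj (weightedP η k)).re
        + ((σ.rhsQ P Q - σ.rhsQ p q) k * conj (coordQ η k)).re
      ≤ C * (‖weightedP η k‖ * ‖(σ.F P Q - σ.F p q) k‖)
        + E * (‖coordQ η k‖ * ‖(σ.B k : ℂ)‖) := by
    intro k hk
    have hW : (σ.W k : ℂ) ≠ 0 := Complex.ofReal_ne_zero.2 (hσ.W_pos k).ne'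
    -- On the modes `|k| ≤ N` truncation changes nothing, so the linear terms see only the
    -- perturbation `η`, without any truncation error.
    have ePk : σ.W k * P k = σ.W k * p k + weightedP η k := by
      rw [hP, coordP_add, coordP_toPhase hσ.W_pos, Pi.add_apply, mul_add, coordP,
        mul_inv_cancel_left₀ hW]
      simp only [lowPass, hk, if_true]
    have eQk : Q k = q k + coordQ η k := by
      rw [hQ, coordQ_add, coordQ_toPhase, Pi.add_apply]
      simp only [lowPass, hk, if_true]
    set f := (σ.F P Q - σ.F p q) k with hf
    set g := σ.G P Q k - σ.G p q k with hg
    set x := weightedP η k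
    set y := coordQ η k
    have e1 : σ.W k * (σ.rhsP P Q - σ.rhsP p q) k * conj x
        = -Complex.I * (σ.W k * σ.α k : ℝ) * (y * conj x)
          + -Complex.I * (σ.W k * σ.A k : ℝ) * (f * conj x) := by
      simp only [hf, Pi.sub_apply, rhsP, eQk, Complex.ofReal_mul]
      ring
    have e2 : (σ.rhsQ P Q - σ.rhsQ p q) k * conj y
        = -Complex.I * (σ.W k * σ.α k : ℝ) * (x * conj y)
          + -Complex.I * (σ.B k : ℝ) * (g * conj y) := by
      have : (σ.W k : ℂ) ^ 2 * σ.α k * P k = σ.W k * σ.α k * (σ.W k * p k + x) := by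
        rw [← ePk]
        ring
      simp only [hg, Pi.sub_apply, rhsQ, this, Complex.ofReal_mul]
      ring
    -- Both couplings have the same real symbol `W α`, and `y * conj x`, `x * conj y` are conjugate
    -- to each other. Their sum is real, and the factor `-i` makes it imaginary.
    have e3 : (-Complex.I * (σ.W k * σ.α k : ℝ) * (y * conj x)).re
        + (-Complex.I * (σ.W k * σ.α k : ℝ) * (x * conj y)).re = 0 := by
      simp [Complex.mul_re, Complex.mul_im]
      ring
    have h1 : (-Complex.I * (σ.W k * σ.A k : ℝ) * (f * conj x)).re ≤ C * (‖x‖ * ‖f‖) := by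
      refine (Complex.re_le_norm _).trans ?_
      simp only [norm_mul, norm_neg, Complex.norm_I, one_mul, Complex.norm_real, Real.norm_eq_abs,
        RCLike.norm_conj]
      rw [mul_comm ‖f‖, ← abs_mul]
      exact mul_le_mul_of_nonneg_right (hσ.WA_le k) (by positivity)
    have h2 : (-Complex.I * (σ.B k : ℝ) * (g * conj y)).re ≤ E * (‖y‖ * ‖(σ.B k : ℂ)‖) := by
      refine (Complex.re_le_norm _).trans ?_
      simp only [norm_mul, norm_neg, Complex.norm_I, one_mul, RCLike.norm_conj]
      calc ‖(σ.B k : ℂ)‖ * (‖g‖ * ‖y‖) ≤ ‖(σ.B k : ℂ)‖ * (E * ‖y‖) := by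
            gcongr
            exact hG k
        _ = E * (‖y‖ * ‖(σ.B k : ℂ)‖) := by ring
    rw [e1, e2, Complex.add_re, Complex.add_re]
    linarith
  refine (Finset.sum_le_sum hterm).trans ?_
  rw [Finset.sum_add_distrib, ← Finset.mul_sum, ← Finset.mul_sum]
  have h1 := (ellTwoLe_weightedP η).sum_mul_le hF (Finset.Icc (-(N : ℤ)) N)
  have h2 := (ellTwoLe_coordQ η).sum_mul_le hσ.B_le (Finset.Icc (-(N : ℤ)) N)
  calc _ ≤ C * (‖η‖ * D) + E * (‖η‖ * C) := by gcongr
    _ = C * ‖η‖ * (D + E) := by ring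

/-- Existence of the Galerkin approximation on the whole time interval of existence of an exact
solution, with an error of the size of the truncation error. -/
theorem IsExact.exists_isGalerkin {C T M : ℝ} (hσ : σ.Bounded C) (hT : 0 ≤ T)
    {p q : ℝ → ℤ → ℂ} (h : σ.IsExact T p q)
    (hp : ∀ t ∈ Icc 0 T, EllOneLe (p t) M) (hq : ∀ t ∈ Icc 0 T, EllOneLe (q t) M) :
    ∃ D : ℝ, 0 < D ∧ ∀ (N : ℕ) (ε : ℝ),
      (∀ t ∈ Icc 0 T, EllTwoLe (lowPass N (p t) - p t) ε) →
      (∀ t ∈ Icc 0 T, EllTwoLe (lowPass N (q t) - q t) ε) → D * ε ≤ 1 →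
      ∃ z w : ℝ → ℤ → ℂ, σ.IsGalerkin T N z w ∧ z 0 = lowPass N (p 0) ∧ w 0 = lowPass N (q 0) ∧
        ∀ t ∈ Icc 0 T, EllTwoLe (z t - p t) (D * ε) ∧ EllTwoLe (w t - q t) (D * ε) := by
  obtain ⟨S, hS0, hS⟩ := exists_sum_one_add_sq_inv_le
  have hC0 : 0 ≤ C := zero_le_one.trans hσ.one_le
  have h0 : (0 : ℝ) ∈ Icc 0 T := left_mem_Icc.2 hT
  have hM : 0 ≤ M := (hp 0 h0).nonneg
  -- For `‖η‖ ≤ 1`, `C * S` bounds the first component of `η` in `ℓ¹`, `M` the truncation error in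
  -- `ℓ¹`, and `1` the second component of `η` in `ℓ²`.
  set M₁ := C * S + M + 1 with hM₁
  have hM₁0 : 0 ≤ M₁ := by positivity
  set K := C * ((|σ.f₁| + |σ.f₂|) * (3 * M₁ * C) + (|σ.g₁| + |σ.g₂|) * (3 * M₁ * C)) with hK
  have hK0 : 0 ≤ K := by positivity
  -- The exponential bounds the distance to the truncated exact solution in the energy norm, `C`
  -- passes from `W p` to `p`, and the summand `1` accounts for the truncation error.
  refine ⟨C * Real.exp (2 * K * T) + 1, by positivity, fun N ε hpε hqε hsmall => ?_⟩
  have hε : 0 ≤ ε := (hpε 0 h0).1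
  have hexp : Real.exp (2 * K * T) ≤ C * Real.exp (2 * K * T) :=
    le_mul_of_one_le_left (Real.exp_pos _).le hσ.one_le
  have hest : ∀ t ∈ Icc 0 T, ∀ η : Phase N, ‖η‖ ≤ 1 →
      inner ℝ η (σ.field (σ.toPhase N (p t) (q t) + η)
        - σ.toPhase N (σ.rhsP (p t) (q t)) (σ.rhsQ (p t) (q t))) ≤ K * ‖η‖ * (‖η‖ + ε) := by
    intro t ht η hη
    have hwη : EllTwoLe (fun k => (σ.W k : ℂ) * σ.coordP η k) ‖η‖ := by
      refine (ellTwoLe_weightedP η).of_norm_le fun k => le_of_eq ?_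
      rw [coordP, mul_inv_cancel_left₀ (Complex.ofReal_ne_zero.2 (hσ.W_pos k).ne')]
    have ha1 : EllOneLe (σ.coordP η + (lowPass N (p t) - p t)) M₁ :=
      ((hwη.ellOneLe_of_weight hS0 hS hC0 hσ.le_W).add
        ((hp t ht).of_norm_le (norm_lowPass_sub_le N (p t)))).mono
        (by nlinarith [mul_nonneg hC0 hS0])
    -- Only the `ℓ²` size `ε` of the truncation error is used for smallness; in `ℓ¹` it merely has
    -- to stay bounded. No power of `N` is lost to the derivative in the energy norm.
    have ha2 : EllTwoLe (σ.coordP η + (lowPass N (p t) - p t)) (C * (‖η‖ + ε)) :=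
      ((hwη.of_weight hC0 hσ.le_W).add (hpε t ht)).mono (by nlinarith [hσ.one_le])
    have hb1 : EllTwoLe (coordQ η + (lowPass N (q t) - q t)) M₁ :=
      ((ellTwoLe_coordQ η).add
        ((hq t ht).of_norm_le (norm_lowPass_sub_le N (q t))).ellTwoLe).mono
        (by nlinarith [mul_nonneg hC0 hS0])
    have hb2 : EllTwoLe (coordQ η + (lowPass N (q t) - q t)) (C * (‖η‖ + ε)) :=
      ((ellTwoLe_coordQ η).add (hqε t ht)).mono
        (by nlinarith [hσ.one_le, norm_nonneg η])
    have hpM := (hp t ht).mono (M' := M₁) (by linarith [mul_nonneg hC0 hS0])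
    have hqM := (hq t ht).mono (M' := M₁) (by linarith [mul_nonneg hC0 hS0])
    have eP : σ.coordP (σ.toPhase N (p t) (q t) + η)
        = p t + (σ.coordP η + (lowPass N (p t) - p t)) := by
      rw [coordP_add, coordP_toPhase hσ.W_pos]
      abel
    have eQ : coordQ (σ.toPhase N (p t) (q t) + η)
        = q t + (coordQ η + (lowPass N (q t) - q t)) := by
      rw [coordQ_add, coordQ_toPhase]
      abel
    refine (inner_field_sub_le hσ (p t) (q t) η
      (D := (|σ.f₁| + |σ.f₂|) * (3 * M₁ * (C * (‖η‖ + ε))))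
      (E := (|σ.g₁| + |σ.g₂|) * (3 * M₁ * (C * (‖η‖ + ε)))) ?_ ?_).trans_eq ?_
    · rw [eP, eQ]
      exact ellTwoLe_F_sub hpM hqM ha1 ha2 hb2
    · rw [eP, eQ]
      exact norm_G_sub_le hpM.ellTwoLe hqM.ellTwoLe ha1.ellTwoLe hb1 ha2 hb2
    · rw [hK]
      ring
  obtain ⟨y, hy0, hy, hclose⟩ := exists_solution_near (σ.contDiff_field (N := N)) hT hK0 hε
    (h.hasDerivWithinAt_toPhase N) hest (by nlinarith)
  refine ⟨_, _, isGalerkin_of_hasDerivWithinAt hσ.W_pos hy, ?_, ?_, fun t ht => ⟨?_, ?_⟩⟩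
  · simp only [hy0, coordP_toPhase hσ.W_pos]
  · simp only [hy0, coordQ_toPhase]
  · have h1 : EllTwoLe (fun k => (σ.W k : ℂ) * σ.coordP (y t - σ.toPhase N (p t) (q t)) k)
        (Real.exp (2 * K * T) * ε) := by
      refine ((ellTwoLe_weightedP _).mono (hclose t ht)).of_norm_le fun k => le_of_eq ?_
      rw [coordP, mul_inv_cancel_left₀ (Complex.ofReal_ne_zero.2 (hσ.W_pos k).ne')]
    convert (h1.of_weight hC0 hσ.le_W).add (hpε t ht) using 1
    · have e : σ.coordP (y t) = σ.coordP (y t - σ.toPhase N (p t) (q t)) + lowPass N (p t) := by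
        rw [← coordP_toPhase hσ.W_pos (p t) (q t), ← coordP_add, sub_add_cancel]
      rw [e]
      abel
    · ring
  · have e : coordQ (y t) = coordQ (y t - σ.toPhase N (p t) (q t)) + lowPass N (q t) := by
      rw [← coordQ_toPhase (σ := σ) (p t) (q t), ← coordQ_add, sub_add_cancel]
    refine ((((ellTwoLe_coordQ _).mono (hclose t ht)).add (hqε t ht)).mono
      (M' := (C * Real.exp (2 * K * T) + 1) * ε) (by nlinarith)).of_norm_le fun k => le_of_eq ?_
    rw [e, add_sub_assoc]

end DispersiveSystem

/-! ### Exponentials, trigonometric sums and inner products -/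

theorem expMode_eq_fourier (k : ℤ) (x : ℝ) : expMode k x = fourier k (x : UnitAddCircle) := by
  rw [expMode, fourier_coe_apply, Complex.ofReal_one, div_one]

theorem expMode_add (j k : ℤ) (x : ℝ) : expMode (j + k) x = expMode j x * expMode k x := by
  rw [expMode, expMode, expMode, ← Complex.exp_add]
  push_cast
  ring_nf

theorem conj_expMode (k : ℤ) (x : ℝ) : conj (expMode k x) = expMode (-k) x := by
  rw [expMode, expMode, ← Complex.exp_conj]
  simp [map_ofNat]

theorem hasDerivAt_expMode (k : ℤ) (x : ℝ) :
    HasDerivAt (expMode k) (2 * Real.pi * Complex.I * k * expMode k x) x := by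
  have h := hasDerivAt_fourier (1 : ℝ) k x
  rw [Complex.ofReal_one, div_one, ← expMode_eq_fourier] at h
  exact h.congr_of_eventuallyEq (Filter.Eventually.of_forall (expMode_eq_fourier k))

theorem contDiff_expMode (k : ℤ) : ContDiff ℝ ∞ (expMode k) :=
  Complex.contDiff_exp.comp (contDiff_const.mul Complex.ofRealCLM.contDiff)

theorem periodic_expMode (k : ℤ) : Function.Periodic (expMode k) 1 := by
  intro x
  rw [expMode_eq_fourier, expMode_eq_fourier]
  congr 1
  exact AddCircle.coe_add_period 1 x

theorem iteratedDeriv_expMode (k : ℤ) (n : ℕ) :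
    iteratedDeriv n (expMode k) = fun x => (2 * Real.pi * Complex.I * k) ^ n * expMode k x := by
  induction n with
  | zero => simp
  | succ n ih =>
    rw [iteratedDeriv_succ, ih]
    funext x
    rw [((hasDerivAt_expMode k x).const_mul _).deriv]
    ring

theorem ip_const_mul_right (f : ℝ → ℝ) (c : ℂ) (g : ℝ → ℂ) :
    ip f (fun x => c * g x) = conj c * ip f g := by
  rw [ip, ip, ← intervalIntegral.integral_const_mul]
  congr 1
  funext x
  rw [map_mul]
  ring

theorem conj_two_pi_I (k : ℤ) :
    conj (2 * Real.pi * Complex.I * k : ℂ) = -(2 * Real.pi * Complex.I * k) := by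
  simp [map_ofNat]

theorem ip_iteratedDeriv_expMode (f : ℝ → ℝ) (k : ℤ) (n : ℕ) :
    ip f (iteratedDeriv n (expMode k)) = (-(2 * Real.pi * Complex.I * k)) ^ n * ip f (expMode k) := by
  rw [iteratedDeriv_expMode, ip_const_mul_right, map_pow, conj_two_pi_I]

theorem ip_deriv_expMode (f : ℝ → ℝ) (k : ℤ) :
    ip f (deriv (expMode k)) = -(2 * Real.pi * Complex.I * k) * ip f (expMode k) := by
  have := ip_iteratedDeriv_expMode f k 1
  rwa [iteratedDeriv_one, pow_one] at this

theorem ip_expMode (f : ℝ → ℝ) (k : ℤ) :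
    ip f (expMode k) = ∫ x in (0 : ℝ)..1, expMode (-k) x * f x := by
  rw [ip]
  simp only [conj_expMode, mul_comm]

/-- Integration by parts against an exponential. -/
theorem ip_deriv_left {f : ℝ → ℝ} (hf : ContDiff ℝ ∞ f) (hp : Function.Periodic f 1) (k : ℤ) :
    ip (deriv f) (expMode k) = 2 * Real.pi * Complex.I * k * ip f (expMode k) := by
  have hd : ∀ x, HasDerivAt (fun x => (f x : ℂ)) ((deriv f x : ℝ) : ℂ) x := fun x =>
    ((hf.differentiable (by simp)).differentiableAt.hasDerivAt).ofReal_comp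
  have hc : Continuous fun x => ((deriv f x : ℝ) : ℂ) :=
    Complex.continuous_ofReal.comp (hf.continuous_deriv (by simp))
  have he : Continuous fun x => 2 * Real.pi * Complex.I * ((-k : ℤ) : ℂ) * expMode (-k) x :=
    continuous_const.mul (contDiff_expMode (-k)).continuous
  have h := intervalIntegral.integral_mul_deriv_eq_deriv_mul (a := 0) (b := 1)
    (fun x _ => hasDerivAt_expMode (-k) x) (fun x _ => hd x)
    (he.intervalIntegrable _ _) (hc.intervalIntegrable _ _)
  have e1 : f 1 = f 0 := by simpa using hp 0
  have e2 : expMode (-k) 1 = expMode (-k) 0 := by simpa using periodic_expMode (-k) 0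
  rw [ip_expMode, ip_expMode, h, e1, e2, sub_self, zero_sub, ← intervalIntegral.integral_neg,
    ← intervalIntegral.integral_const_mul]
  congr 1
  funext x
  push_cast
  ring

theorem Function.Periodic.deriv_real {f : ℝ → ℝ} {c : ℝ} (hp : Function.Periodic f c) :
    Function.Periodic (deriv f) c := by
  intro x
  rw [← deriv_comp_add_const]
  congr 1
  exact funext hp

theorem ip_iteratedDeriv_left {f : ℝ → ℝ} (hf : ContDiff ℝ ∞ f) (hp : Function.Periodic f 1)
    (k : ℤ) (n : ℕ) :
    ip (iteratedDeriv n f) (expMode k) = (2 * Real.pi * Complex.I * k) ^ n * ip f (expMode k) := by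
  induction n generalizing f with
  | zero => simp
  | succ n ih =>
    rw [iteratedDeriv_succ', ih (contDiff_infty_iff_deriv.1 hf).2 hp.deriv_real,
      ip_deriv_left hf hp]
    ring

/-- The trigonometric polynomial with coefficients `c k`, `|k| ≤ N`. -/
noncomputable def trigSum (N : ℕ) (c : ℤ → ℂ) (x : ℝ) : ℂ :=
  ∑ k ∈ Finset.Icc (-(N : ℤ)) N, c k * expMode k x

theorem contDiff_trigSum (N : ℕ) (c : ℤ → ℂ) : ContDiff ℝ ∞ (trigSum N c) :=
  ContDiff.sum fun k _ => contDiff_const.mul (contDiff_expMode k)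

theorem periodic_trigSum (N : ℕ) (c : ℤ → ℂ) : Function.Periodic (trigSum N c) 1 := by
  intro x
  simp only [trigSum, periodic_expMode _ x]

theorem expMode_mem_trigSpace {N : ℕ} {k : ℤ} (hk : k ∈ Finset.Icc (-(N : ℤ)) N) :
    expMode k ∈ trigSpace N :=
  Submodule.subset_span ⟨k, Finset.mem_Icc.1 hk, rfl⟩

theorem mem_trigSpace_iff {N : ℕ} {f : ℝ → ℂ} : f ∈ trigSpace N ↔ ∃ c, f = trigSum N c := by
  constructor
  · intro hf
    induction hf using Submodule.span_induction with
    | mem f hf =>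
      obtain ⟨k, hk, rfl⟩ := hf
      refine ⟨Pi.single k 1, ?_⟩
      funext x
      rw [trigSum, Finset.sum_eq_single_of_mem k (Finset.mem_Icc.2 hk)]
      · simp
      · intro j _ hj
        simp [hj]
    | zero => exact ⟨0, by funext x; simp [trigSum]⟩
    | add f g _ _ hf hg =>
      obtain ⟨c, rfl⟩ := hf
      obtain ⟨d, rfl⟩ := hg
      refine ⟨c + d, ?_⟩
      funext x
      simp [trigSum, add_mul, Finset.sum_add_distrib]
    | smul a f _ hf =>
      obtain ⟨c, rfl⟩ := hf
      refine ⟨a • c, ?_⟩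
      funext x
      simp [trigSum, Finset.mul_sum, mul_assoc]
  · rintro ⟨c, rfl⟩
    have : trigSum N c = ∑ k ∈ Finset.Icc (-(N : ℤ)) N, c k • expMode k := by
      funext x
      simp [trigSum]
    rw [this]
    exact Submodule.sum_mem _ fun k hk => Submodule.smul_mem _ _ (expMode_mem_trigSpace hk)

theorem contDiff_of_ofReal_eq_trigSum {N : ℕ} {c : ℤ → ℂ} {f : ℝ → ℝ}
    (hf : ∀ x, (f x : ℂ) = trigSum N c x) : ContDiff ℝ ∞ f := by
  have : f = fun x => Complex.reCLM (trigSum N c x) := by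
    funext x
    rw [← hf x, Complex.reCLM_apply, Complex.ofReal_re]
  rw [this]
  exact Complex.reCLM.contDiff.comp (contDiff_trigSum N c)

theorem periodic_of_ofReal_eq_trigSum {N : ℕ} {c : ℤ → ℂ} {f : ℝ → ℝ}
    (hf : ∀ x, (f x : ℂ) = trigSum N c x) : Function.Periodic f 1 := by
  intro x
  apply Complex.ofReal_injective
  rw [hf, hf, periodic_trigSum]

theorem integral_expMode (k : ℤ) :
    ∫ x in (0 : ℝ)..1, expMode k x = if k = 0 then 1 else 0 := by
  split_ifs with hk
  · simp [hk, expMode]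
  · have h := intervalIntegral.integral_eq_sub_of_hasDerivAt (a := 0) (b := 1)
      (fun x _ => hasDerivAt_expMode k x)
      ((continuous_const.mul (contDiff_expMode k).continuous).intervalIntegrable _ _)
    rw [intervalIntegral.integral_const_mul] at h
    have e : expMode k 1 = expMode k 0 := by simpa using periodic_expMode k 0
    rw [e, sub_self] at h
    refine (mul_eq_zero.1 h).resolve_left ?_
    simp [hk, Real.pi_ne_zero]

theorem ip_trigSum {N : ℕ} {c : ℤ → ℂ} {f : ℝ → ℝ} (hf : ∀ x, (f x : ℂ) = trigSum N c x) (k : ℤ) :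
    ip f (expMode k) = lowPass N c k := by
  rw [ip_expMode]
  simp only [hf, trigSum, Finset.mul_sum]
  have hc : ∀ j, Continuous fun x => expMode (-k) x * (c j * expMode j x) := fun j =>
    (contDiff_expMode (-k)).continuous.mul (continuous_const.mul (contDiff_expMode j).continuous)
  rw [intervalIntegral.integral_finsetSum fun j _ => (hc j).intervalIntegrable _ _]
  have : ∀ j, ∫ x in (0 : ℝ)..1, expMode (-k) x * (c j * expMode j x)
      = c j * if -k + j = 0 then 1 else 0 := by
    intro j
    rw [← integral_expMode, ← intervalIntegral.integral_const_mul]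
    congr 1
    funext x
    rw [expMode_add]
    ring
  simp only [this, neg_add_eq_zero, mul_ite, mul_one, mul_zero, lowPass]
  rw [Finset.sum_ite_eq]

theorem ip_mul_trigSum {N : ℕ} {c d : ℤ → ℂ} {f g : ℝ → ℝ} (hf : ∀ x, (f x : ℂ) = trigSum N c x)
    (hg : ∀ x, (g x : ℂ) = trigSum N d x) (k : ℤ) :
    ip (fun x => f x * g x) (expMode k) = conv (lowPass N c) (lowPass N d) k := by
  rw [ip_expMode]
  have hgc : Continuous fun x => (g x : ℂ) :=
    Complex.continuous_ofReal.comp (contDiff_of_ofReal_eq_trigSum hg).continuous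
  simp only [Complex.ofReal_mul, hf, trigSum, Finset.sum_mul, Finset.mul_sum]
  have hc : ∀ j, Continuous fun x => expMode (-k) x * (c j * expMode j x * g x) := fun j =>
    (contDiff_expMode (-k)).continuous.mul
      ((continuous_const.mul (contDiff_expMode j).continuous).mul hgc)
  rw [intervalIntegral.integral_finsetSum fun j _ => (hc j).intervalIntegrable _ _]
  rw [conv, tsum_eq_sum (s := Finset.Icc (-(N : ℤ)) N)]
  · refine Finset.sum_congr rfl fun j hj => ?_
    rw [← ip_trigSum hg, ip_expMode, lowPass, if_pos hj, ← intervalIntegral.integral_const_mul]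
    congr 1
    funext x
    rw [show -(k - j) = -k + j by ring, expMode_add]
    ring
  · intro j hj
    rw [lowPass, if_neg hj, zero_mul]

theorem trigSum_lowPass (N : ℕ) (c : ℤ → ℂ) : trigSum N (lowPass N c) = trigSum N c := by
  funext x
  refine Finset.sum_congr rfl fun k hk => ?_
  rw [lowPass, if_pos hk]

/-- The discrete Fourier transform recovers the coefficients of a trigonometric polynomial. -/
theorem sum_trigSum_mul_expMode (N : ℕ) (c : ℤ → ℂ) {k : ℤ} (hk : k ∈ Finset.Icc (-(N : ℤ)) N) :
    ∑ j ∈ Finset.range (2 * N + 1), trigSum N c (j / (2 * N + 1 : ℝ))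
      * expMode (-k) (j / (2 * N + 1 : ℝ)) = (2 * N + 1) * c k := by
  have hM : (2 * N + 1 : ℂ) ≠ 0 := by exact_mod_cast (Nat.succ_ne_zero (2 * N))
  -- Discrete orthogonality: two modes differ by at most `2N < 2N + 1`, so distinct ones give a
  -- nontrivial root of unity of order dividing `2N + 1`, and its geometric sum vanishes.
  have hgeom : ∀ l ∈ Finset.Icc (-(N : ℤ)) N,
      ∑ j ∈ Finset.range (2 * N + 1), expMode (l - k) (j / (2 * N + 1 : ℝ))
        = if l = k then (2 * N + 1 : ℂ) else 0 := by
    intro l hl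
    split_ifs with h
    · simp [h, expMode]
    · set r : ℂ := Complex.exp (2 * Real.pi * Complex.I * (l - k : ℤ) / (2 * N + 1)) with hr
      have e : ∀ j : ℕ, expMode (l - k) (j / (2 * N + 1 : ℝ)) = r ^ j := by
        intro j
        rw [expMode, hr, ← Complex.exp_nat_mul]
        congr 1
        push_cast
        ring
      have hr1 : r ≠ 1 := by
        intro h1
        obtain ⟨n, hn⟩ := Complex.exp_eq_one_iff.1 h1
        rw [div_eq_iff hM] at hn
        have h2 : ((l - k : ℤ) : ℂ) = ((n * (2 * N + 1) : ℤ) : ℂ) := by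
          apply mul_left_cancel₀ Complex.two_pi_I_ne_zero
          rw [hn]
          push_cast
          ring
        have h3 : l - k = n * (2 * N + 1) := by exact_mod_cast h2
        rw [Finset.mem_Icc] at hl hk
        have h4 : |l - k| < 2 * N + 1 := by
          rw [abs_lt]
          constructor <;> linarith [hl.1, hl.2, hk.1, hk.2]
        have h5 : l - k = 0 := Int.eq_zero_of_abs_lt_dvd ⟨n, by rw [h3, mul_comm]⟩ h4
        exact h (sub_eq_zero.1 h5)
      have hrM : r ^ (2 * N + 1) = 1 := by
        rw [hr, ← Complex.exp_nat_mul, Complex.exp_eq_one_iff]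
        refine ⟨l - k, ?_⟩
        push_cast
        field_simp
      simp only [e]
      rw [geom_sum_eq hr1, hrM, sub_self, zero_div]
  simp only [trigSum, Finset.sum_mul]
  rw [Finset.sum_comm]
  have : ∀ l ∈ Finset.Icc (-(N : ℤ)) N,
      ∑ j ∈ Finset.range (2 * N + 1), c l * expMode l (j / (2 * N + 1 : ℝ))
        * expMode (-k) (j / (2 * N + 1 : ℝ)) = if l = k then c l * (2 * N + 1 : ℂ) else 0 := by
    intro l hl
    have := congrArg (c l * ·) (hgeom l hl)
    simp only [Finset.mul_sum, sub_eq_add_neg, expMode_add, mul_ite, mul_zero] at this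
    rw [← this]
    exact Finset.sum_congr rfl fun j _ => by ring
  rw [Finset.sum_congr rfl this, Finset.sum_ite_eq', if_pos hk, mul_comm]

theorem ip_trigSum_right {f : ℝ → ℝ} (hf : Continuous f) (N : ℕ) (c : ℤ → ℂ) :
    ip f (trigSum N c) = ∑ k ∈ Finset.Icc (-(N : ℤ)) N, conj (c k) * ip f (expMode k) := by
  simp only [← ip_const_mul_right]
  have hc : ∀ k, Continuous fun x => (f x : ℂ) * conj (c k * expMode k x) := fun k =>
    (Complex.continuous_ofReal.comp hf).mul (Complex.continuous_conj.comp
      (continuous_const.mul (contDiff_expMode k).continuous))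
  unfold ip
  rw [← intervalIntegral.integral_finsetSum fun k _ => (hc k).intervalIntegrable _ _]
  simp only [trigSum, map_sum, Finset.mul_sum]

/-- Bessel's bound for the `L²` norm, from the Fourier coefficients. -/
theorem l2norm_le_of_ellTwoLe {f : ℝ → ℝ} (hf : MemLp f 2 (volume.restrict (Ioc 0 1))) {K : ℝ}
    (h : EllTwoLe (fun k => ip f (expMode k)) K) : l2norm f ≤ K := by
  have h1 := hasSum_sq_fourierCoeffOn (zero_lt_one' ℝ) hf.ofReal
  have h2 : ∀ k, fourierCoeffOn (zero_lt_one' ℝ) (fun x => ((f x : ℝ) : ℂ)) k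
      = ip f (expMode k) := by
    intro k
    rw [fourierCoeffOn_eq_integral, ip_expMode, sub_zero, div_one, one_smul]
    refine intervalIntegral.integral_congr fun x _ => ?_
    simp only [smul_eq_mul, expMode, fourier_coe_apply, Complex.ofReal_one, div_one]
  have h3 : ∫ x in (0 : ℝ)..1, f x ^ 2 ≤ K ^ 2 := by
    have h4 := h1.tsum_eq
    simp only [RCLike.ofReal_eq_complex_ofReal, h2, Complex.norm_real, Real.norm_eq_abs, sq_abs, sub_zero, inv_one, one_smul] at h4 h1
    rw [← h4]
    exact h1.summable.tsum_le_of_sum_le h.2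
  rw [l2norm, Real.sqrt_le_left h.1]
  exact h3

/-! ### Fourier coefficients of elements of `H^μ` -/

theorem memLp_comp_coe {f : UnitAddCircle → ℝ} (hf : MemLp f 2 haarAddCircle) :
    MemLp (fun x : ℝ => f (x : UnitAddCircle)) 2 (volume.restrict (Ioc 0 1)) := by
  have h := AddCircle.measurePreserving_mk (1 : ℝ) 0
  rw [volume_eq_smul_haarAddCircle, ENNReal.ofReal_one, one_smul, zero_add] at h
  exact hf.comp_measurePreserving h

theorem PerSobolev.memLp_fn {μ : ℝ} (f : PerSobolev μ) :
    MemLp f.fn 2 (volume.restrict (Ioc 0 1)) :=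
  memLp_comp_coe (Lp.memLp f.toL2)

theorem fourierCoeff_eq_ip (f : UnitAddCircle → ℝ) (k : ℤ) :
    fourierCoeff (fun x => (f x : ℂ)) k = ip (fun x : ℝ => f x) (expMode k) := by
  rw [fourierCoeff_eq_intervalIntegral _ _ 0, ip_expMode]
  simp only [zero_add, div_one, one_smul, smul_eq_mul, expMode_eq_fourier]

theorem PerSobolev.ip_fn {μ : ℝ} (f : PerSobolev μ) (k : ℤ) :
    ip f.fn (expMode k) = perCoeff f.toL2 k :=
  (fourierCoeff_eq_ip _ k).symm

theorem conj_perCoeff (f : L2Per) (k : ℤ) : conj (perCoeff f k) = perCoeff f (-k) := by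
  unfold perCoeff fourierCoeff
  rw [← integral_conj]
  congr 1
  funext x
  simp only [smul_eq_mul, map_mul, Complex.conj_ofReal, neg_neg, fourier_neg, Complex.conj_conj]

theorem memLp_fourier_mul (f : L2Per) (k : ℤ) :
    MemLp (fun x : UnitAddCircle => fourier k x * ((f x : ℝ) : ℂ)) 2 haarAddCircle := by
  have hf : MemLp (fun x => ((f x : ℝ) : ℂ)) 2 haarAddCircle := (Lp.memLp f).ofReal
  refine hf.of_le ((fourier k).continuous.aestronglyMeasurable.mul hf.1)
    (Filter.Eventually.of_forall fun x => le_of_eq ?_)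
  rw [norm_mul, show ‖fourier k x‖ = 1 from Circle.norm_coe _, one_mul]

theorem fourierCoeff_fourier_mul (f : L2Per) (k j : ℤ) :
    fourierCoeff (memLp_fourier_mul f k).toLp j = perCoeff f (j - k) := by
  rw [fourierCoeff_congr_ae (memLp_fourier_mul f k).coeFn_toLp]
  unfold perCoeff fourierCoeff
  congr 1
  funext x
  simp only [smul_eq_mul]
  rw [← mul_assoc, ← fourier_add, show -j + k = -(j - k) by ring]

/-- Writing the coefficient of `f g` as an inner product of two `L²` functions allows Parseval's
identity to be applied; multiplication by a character merely shifts the coefficients of `f`. -/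
theorem inner_fourier_mul (f g : L2Per) (k : ℤ)
    (hg : MemLp (fun x => ((g x : ℝ) : ℂ)) 2 haarAddCircle) :
    inner ℂ (memLp_fourier_mul f k).toLp hg.toLp
      = fourierCoeff (fun x => ((f x * g x : ℝ) : ℂ)) k := by
  rw [MeasureTheory.L2.inner_def]
  apply integral_congr_ae
  filter_upwards [(memLp_fourier_mul f k).coeFn_toLp, hg.coeFn_toLp] with x hx hx'
  rw [hx, hx', RCLike.inner_apply', fourier_neg, smul_eq_mul]
  simp only [map_mul, Complex.conj_ofReal, Complex.ofReal_mul]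
  ring

/-- The Fourier coefficients of a product are given by the convolution. -/
theorem fourierCoeff_mul_eq_conv (f g : L2Per) (k : ℤ) :
    fourierCoeff (fun x => ((f x * g x : ℝ) : ℂ)) k = conv (perCoeff f) (perCoeff g) k := by
  have hg : MemLp (fun x => ((g x : ℝ) : ℂ)) 2 haarAddCircle := (Lp.memLp g).ofReal
  have hterm : ∀ j, inner ℂ (memLp_fourier_mul f k).toLp (fourierBasis (T := (1 : ℝ)) j)
      * inner ℂ (fourierBasis (T := (1 : ℝ)) j) hg.toLp = perCoeff g j * perCoeff f (k - j) := by
    intro j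
    rw [← inner_conj_symm, ← HilbertBasis.repr_apply_apply, ← HilbertBasis.repr_apply_apply,
      fourierBasis_repr, fourierBasis_repr, fourierCoeff_fourier_mul, conj_perCoeff, mul_comm,
      neg_sub, fourierCoeff_congr_ae hg.coeFn_toLp]
    rfl
  rw [← inner_fourier_mul f g k hg, conv_comm, conv,
    ← (fourierBasis (T := (1 : ℝ))).tsum_inner_mul_inner]
  exact tsum_congr hterm

theorem PerSobolev.ip_fn_mul {μ : ℝ} (f g : PerSobolev μ) (k : ℤ) :
    ip (fun x => f.fn x * g.fn x) (expMode k)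
      = conv (perCoeff f.toL2) (perCoeff g.toL2) k := by
  rw [← fourierCoeff_mul_eq_conv, fourierCoeff_eq_ip (fun x => f.toL2 x * g.toL2 x)]
  rfl

theorem PerSobolev.ellTwoLe_weightedCoeff {μ : ℝ} (f : PerSobolev μ) :
    EllTwoLe (weightedCoeff μ f.toL2) ‖f‖ := by
  refine ⟨norm_nonneg _, fun s => ?_⟩
  have h := lp.sum_rpow_le_norm_rpow (p := 2) (by norm_num) (PerSobolev.toSeq μ f) s
  simp only [ENNReal.toReal_ofNat, Real.rpow_ofNat] at h
  exact h

/-- The assumption `1 ≤ μ` enters here: the `H^μ` weight dominates the `H¹` weight, which makes the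
coefficients absolutely summable. -/
theorem one_add_sq_le_weight_sq {μ : ℝ} (hμ : 1 ≤ μ) (k : ℤ) :
    1 + (k : ℝ) ^ 2 ≤ 1 ^ 2 * ((1 + (k : ℝ) ^ 2) ^ (μ / 2)) ^ 2 := by
  have h1 : (1 : ℝ) ≤ 1 + (k : ℝ) ^ 2 := by nlinarith [sq_nonneg (k : ℝ)]
  rw [one_pow, one_mul, ← Real.rpow_natCast (_ ^ _), ← Real.rpow_mul (by linarith)]
  conv_lhs => rw [← Real.rpow_one (1 + (k : ℝ) ^ 2)]
  apply Real.rpow_le_rpow_of_exponent_le h1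
  push_cast
  linarith

theorem PerSobolev.ellTwoLe_perCoeff {μ : ℝ} (hμ : 1 ≤ μ) (f : PerSobolev μ) :
    EllTwoLe (perCoeff f.toL2) ‖f‖ := by
  simpa using EllTwoLe.of_weight (w := fun k : ℤ => (1 + (k : ℝ) ^ 2) ^ (μ / 2)) zero_le_one
    (one_add_sq_le_weight_sq hμ) f.ellTwoLe_weightedCoeff

theorem PerSobolev.exists_ellOneLe_perCoeff {μ : ℝ} (hμ : 1 ≤ μ) :
    ∃ S : ℝ, 0 ≤ S ∧ ∀ f : PerSobolev μ, EllOneLe (perCoeff f.toL2) (S * ‖f‖) := by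
  obtain ⟨S, hS0, hS⟩ := exists_sum_one_add_sq_inv_le
  refine ⟨S, hS0, fun f => ?_⟩
  simpa using EllTwoLe.ellOneLe_of_weight hS0 hS (w := fun k : ℤ => (1 + (k : ℝ) ^ 2) ^ (μ / 2))
    zero_le_one (one_add_sq_le_weight_sq hμ) f.ellTwoLe_weightedCoeff

/-- The truncation error in `L²` for functions in `H^μ`. -/
theorem PerSobolev.ellTwoLe_lowPass_sub {μ : ℝ} (hμ : 1 ≤ μ) (f : PerSobolev μ) {N : ℕ}
    (hN : 1 ≤ N) :
    EllTwoLe (lowPass N (perCoeff f.toL2) - perCoeff f.toL2) ((N : ℝ) ^ (-μ) * ‖f‖) := by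
  have hN0 : (0 : ℝ) < N := by exact_mod_cast hN
  have hpos : (0 : ℝ) < (N : ℝ) ^ (-μ) := Real.rpow_pos_of_pos hN0 _
  have h := f.ellTwoLe_weightedCoeff.const_smul (((N : ℝ) ^ (-μ) : ℝ) : ℂ)
  rw [Complex.norm_real, Real.norm_of_nonneg hpos.le] at h
  refine h.of_norm_le fun k => ?_
  by_cases hk : k ∈ Finset.Icc (-(N : ℤ)) N
  · simp only [Pi.sub_apply, lowPass, hk, if_true, sub_self, norm_zero]
    positivity
  · simp only [Pi.sub_apply, lowPass, hk, if_false, zero_sub, norm_neg, Pi.smul_apply,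
      smul_eq_mul, weightedCoeff]
    have hNk : (N : ℝ) ^ 2 ≤ 1 + (k : ℝ) ^ 2 := by
      have h1 : (N : ℤ) ≤ |k| := by
        by_contra hlt
        exact hk (Finset.mem_Icc.2 (abs_le.1 (not_le.1 hlt).le))
      have h2 : (N : ℝ) ≤ |(k : ℝ)| := by exact_mod_cast h1
      have h3 := pow_le_pow_left₀ hN0.le h2 2
      rw [sq_abs] at h3
      linarith
    have hw : (N : ℝ) ^ μ ≤ (1 + (k : ℝ) ^ 2) ^ (μ / 2) := by
      have := Real.rpow_le_rpow (by positivity) hNk (show 0 ≤ μ / 2 by linarith)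
      rwa [← Real.rpow_natCast (N : ℝ), ← Real.rpow_mul hN0.le, Nat.cast_ofNat,
        mul_div_cancel₀ _ (two_ne_zero' ℝ)] at this
    rw [norm_mul, norm_mul, Complex.norm_real, Complex.norm_real, Real.norm_of_nonneg hpos.le,
      Real.norm_of_nonneg (by positivity), ← mul_assoc]
    apply le_mul_of_one_le_left (norm_nonneg _)
    rw [Real.rpow_neg hN0.le, inv_mul_eq_div, one_le_div (Real.rpow_pos_of_pos hN0 _)]
    exact hw

/-- The `k`-th Fourier coefficient as a continuous functional on `H^μ`. -/
noncomputable def PerSobolev.coeffCLM {μ : ℝ} (hμ : 1 ≤ μ) (k : ℤ) : PerSobolev μ →L[ℝ] ℂ :=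
  LinearMap.mkContinuous
    { toFun := fun f => perCoeff f.toL2 k
      map_add' := fun f g => by rw [map_add, perCoeff_add]
      map_smul' := fun r f => by
        rw [map_smul, perCoeff_smul, RingHom.id_apply, Complex.real_smul] } 1 fun f => by
    have h := (f.ellTwoLe_perCoeff hμ).2 {k}
    rw [Finset.sum_singleton] at h
    rw [one_mul]
    exact (pow_le_pow_iff_left₀ (norm_nonneg _) (norm_nonneg _) two_ne_zero).1 h

/-- A continuous linear functional commutes with the time derivative. -/
theorem PerSobolev.hasDerivWithinAt_perCoeff {μ T : ℝ} (hμ : 1 ≤ μ) {f : ℝ → PerSobolev μ}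
    (hf : ContDiffOn ℝ 1 f (Icc 0 T)) {t : ℝ} (ht : t ∈ Icc 0 T) (k : ℤ) :
    HasDerivWithinAt (fun s => perCoeff (f s).toL2 k)
      (perCoeff (derivWithin f (Icc 0 T) t).toL2 k) (Icc 0 T) t :=
  (PerSobolev.coeffCLM hμ k).hasFDerivAt.comp_hasDerivWithinAt t
    ((hf.differentiableOn one_ne_zero) t ht).hasDerivWithinAt

/-! ### The Boussinesq systems in Fourier space -/

/-- The symbol `2πk` of `-i ∂ₓ`. -/
noncomputable def freq (k : ℤ) : ℝ := 2 * Real.pi * k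

theorem freq_neg (k : ℤ) : freq (-k) = -freq k := by
  simp [freq]

theorem sq_le_freq_sq (k : ℤ) : (k : ℝ) ^ 2 ≤ freq k ^ 2 := by
  have h : 1 ≤ (2 * Real.pi) ^ 2 := by nlinarith [Real.pi_gt_three]
  rw [freq, mul_pow]
  exact le_mul_of_one_le_left (sq_nonneg _) h

/-- The right hand side of the first equation, solved for the time derivative. -/
noncomputable def zetaRhs (κ₁ l a b : ℝ) (Z U : ℤ → ℂ) (k : ℤ) : ℂ :=
  -Complex.I * ((freq k * (κ₁ - a * freq k ^ 2) / (1 + b * freq k ^ 2) : ℝ) * U k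
    + (l * freq k / (1 + b * freq k ^ 2) : ℝ) * conv Z U k)

/-- The right hand side of the second equation, solved for the time derivative. -/
noncomputable def uRhs (κ₂ l c d : ℝ) (Z U : ℤ → ℂ) (k : ℤ) : ℂ :=
  -Complex.I * ((freq k * (κ₂ - c * freq k ^ 2) / (1 + d * freq k ^ 2) : ℝ) * Z k
    + (l * freq k / (1 + d * freq k ^ 2) : ℝ) * (1 / 2 * conv U U k))

/-- The dispersive system with symbols `α = νκ / (1 + bν²)`, `W² α = ν(κ' + mν²) / (1 + dν²)`. -/
noncomputable def boussinesqSystem (κ κ' m b d l f₁ f₂ g₁ g₂ : ℝ) : DispersiveSystem where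
  α k := freq k * κ / (1 + b * freq k ^ 2)
  W k := Real.sqrt ((κ' + m * freq k ^ 2) * (1 + b * freq k ^ 2) / (κ * (1 + d * freq k ^ 2)))
  A k := l * freq k / (1 + b * freq k ^ 2)
  B k := l * freq k / (1 + d * freq k ^ 2)
  f₁ := f₁
  f₂ := f₂
  g₁ := g₁
  g₂ := g₂

theorem boussinesqSystem_symmetric (κ κ' m b d l f₁ f₂ g₁ g₂ : ℝ) :
    (boussinesqSystem κ κ' m b d l f₁ f₂ g₁ g₂).Symmetric := by
  constructor <;> intro k <;> simp only [boussinesqSystem, freq_neg, neg_sq] <;> ring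

theorem boussinesqSystem_W_sq {κ κ' m b d : ℝ} (l f₁ f₂ g₁ g₂ : ℝ) (hκ : 0 < κ) (hκ' : 0 < κ')
    (hm : 0 < m) (hb : 0 < b) (hd : 0 < d) (k : ℤ) :
    (boussinesqSystem κ κ' m b d l f₁ f₂ g₁ g₂).W k ^ 2
      = (κ' + m * freq k ^ 2) * (1 + b * freq k ^ 2) / (κ * (1 + d * freq k ^ 2)) :=
  Real.sq_sqrt (by positivity)

/-- `W²` is the quotient of the two linear coupling symbols; this choice symmetrizes the linear
part. -/
theorem boussinesqSystem_W_sq_mul_α {κ κ' m b d : ℝ} (l f₁ f₂ g₁ g₂ : ℝ) (hκ : 0 < κ)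
    (hκ' : 0 < κ') (hm : 0 < m) (hb : 0 < b) (hd : 0 < d) (k : ℤ) :
    (boussinesqSystem κ κ' m b d l f₁ f₂ g₁ g₂).W k ^ 2
        * (boussinesqSystem κ κ' m b d l f₁ f₂ g₁ g₂).α k
      = freq k * (κ' + m * freq k ^ 2) / (1 + d * freq k ^ 2) := by
  rw [boussinesqSystem_W_sq l f₁ f₂ g₁ g₂ hκ hκ' hm hb hd]
  have h1 : 0 < 1 + b * freq k ^ 2 := by positivity
  have h2 : 0 < 1 + d * freq k ^ 2 := by positivity
  simp only [boussinesqSystem]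
  field_simp

/-- With `m`, `b`, `d` positive, `W²` grows like `ν²`, while `A` and `B` decay like `1/ν`. The
positivity of `m` is what gives `W` the strength of a full derivative. -/
theorem boussinesqSystem_bounded {κ κ' m b d : ℝ} (l f₁ f₂ g₁ g₂ : ℝ) (hκ : 0 < κ) (hκ' : 0 < κ')
    (hm : 0 < m) (hb : 0 < b) (hd : 0 < d) :
    ∃ C, (boussinesqSystem κ κ' m b d l f₁ f₂ g₁ g₂).Bounded C := by
  obtain ⟨S, hS0, hS⟩ := exists_sum_one_add_sq_inv_le
  -- `X` bounds `(1 + k²) / W²`, `Y` bounds `(W A)²`, and `R` bounds the sum of `B²`. As the three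
  -- conditions involve the square of the constant, `1 + X + Y + R` serves for all of them.
  set X := κ * ((1 + 1 / b) * (1 / κ' + d / m)) with hX
  set Y := l ^ 2 * (κ' + m / d) / (κ * b) with hY
  set R := l ^ 2 * ((1 + 1 / d) / d) * S ^ 2 with hR
  have hX0 : 0 ≤ X := by positivity
  have hY0 : 0 ≤ Y := by positivity
  have hR0 : 0 ≤ R := by positivity
  have hC : ∀ r ≤ X + Y + R, r ≤ (1 + X + Y + R) ^ 2 := by
    intro r hr
    nlinarith [sq_nonneg (X + Y + R)]
  have hmul : ∀ {r s : ℝ} (ν : ℝ), 0 < r → 0 < s → 1 + ν ^ 2 ≤ (1 / r + 1 / s) * (r + s * ν ^ 2) := by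
    intro r s ν hr hs
    have e : (1 / r + 1 / s) * (r + s * ν ^ 2) = 1 + ν ^ 2 + s / r * ν ^ 2 + r / s := by
      field_simp
      ring
    rw [e]
    have : 0 ≤ s / r * ν ^ 2 := by positivity
    have : 0 ≤ r / s := by positivity
    linarith
  refine ⟨1 + X + Y + R, ⟨by linarith, fun k => ?_, fun k => ?_, fun k => ?_, by positivity,
    fun s => ?_⟩⟩
  · exact Real.sqrt_pos.2 (by positivity)
  · rw [boussinesqSystem_W_sq l f₁ f₂ g₁ g₂ hκ hκ' hm hb hd]
    set ν := freq k with hν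
    have h1 : 1 + (k : ℝ) ^ 2 ≤ (1 + 1 / b) * (1 + b * ν ^ 2) := by
      have := hmul ν one_pos hb
      rw [one_div_one] at this
      linarith [sq_le_freq_sq k]
    have h2 : 1 + d * ν ^ 2 ≤ (1 / κ' + d / m) * (κ' + m * ν ^ 2) := by
      have e : (1 / κ' + d / m) * (κ' + m * ν ^ 2) = 1 + d * ν ^ 2 + m / κ' * ν ^ 2 + d * κ' / m := by
        field_simp
        ring
      rw [e]
      have : 0 ≤ m / κ' * ν ^ 2 := by positivity
      have : 0 ≤ d * κ' / m := by positivity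
      linarith
    have h3 := mul_le_mul h1 h2 (by positivity) (by positivity)
    have hd' : 0 < κ * (1 + d * ν ^ 2) := by positivity
    rw [← mul_div_assoc, le_div_iff₀ hd']
    calc (1 + (k : ℝ) ^ 2) * (κ * (1 + d * ν ^ 2))
        = κ * ((1 + (k : ℝ) ^ 2) * (1 + d * ν ^ 2)) := by ring
      _ ≤ κ * ((1 + 1 / b) * (1 + b * ν ^ 2) * ((1 / κ' + d / m) * (κ' + m * ν ^ 2))) :=
          mul_le_mul_of_nonneg_left h3 hκ.le
      _ = X * ((κ' + m * ν ^ 2) * (1 + b * ν ^ 2)) := by rw [hX]; ring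
      _ ≤ _ := mul_le_mul_of_nonneg_right (hC X (by linarith)) (by positivity)
  · apply abs_le_of_sq_le_sq _ (by positivity)
    rw [mul_pow, boussinesqSystem_W_sq l f₁ f₂ g₁ g₂ hκ hκ' hm hb hd]
    refine le_trans ?_ (hC Y (by linarith))
    simp only [boussinesqSystem]
    set ν := freq k with hν
    have h1 : (κ' + m * ν ^ 2) ≤ (κ' + m / d) * (1 + d * ν ^ 2) := by
      have e : (κ' + m / d) * (1 + d * ν ^ 2) = κ' + m * ν ^ 2 + κ' * d * ν ^ 2 + m / d := by
        field_simp
        ring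
      rw [e]
      have : 0 ≤ κ' * d * ν ^ 2 := by positivity
      have : 0 ≤ m / d := by positivity
      linarith
    have h2 : ν ^ 2 ≤ 1 / b * (1 + b * ν ^ 2) := by
      rw [mul_add, one_div, inv_mul_cancel_left₀ hb.ne']
      have : 0 < b⁻¹ := by positivity
      linarith
    have hB : 0 < 1 + b * ν ^ 2 := by positivity
    have hD : 0 < 1 + d * ν ^ 2 := by positivity
    have h3 := mul_le_mul h1 h2 (by positivity) (by positivity)
    calc (κ' + m * ν ^ 2) * (1 + b * ν ^ 2) / (κ * (1 + d * ν ^ 2))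
          * (l * ν / (1 + b * ν ^ 2)) ^ 2
        = l ^ 2 / (κ * (1 + d * ν ^ 2) * (1 + b * ν ^ 2)) * ((κ' + m * ν ^ 2) * ν ^ 2) := by
          field_simp
      _ ≤ l ^ 2 / (κ * (1 + d * ν ^ 2) * (1 + b * ν ^ 2))
          * ((κ' + m / d) * (1 + d * ν ^ 2) * (1 / b * (1 + b * ν ^ 2))) := by gcongr
      _ = Y := by
          rw [hY]
          field_simp
  · refine le_trans ?_ (hC R (by linarith))
    rw [hR]
    calc ∑ k ∈ s, ‖(((boussinesqSystem κ κ' m b d l f₁ f₂ g₁ g₂).B k : ℝ) : ℂ)‖ ^ 2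
        ≤ ∑ k ∈ s, l ^ 2 * ((1 + 1 / d) / d) * (1 + (k : ℝ) ^ 2)⁻¹ := by
          refine Finset.sum_le_sum fun k _ => ?_
          rw [Complex.norm_real, Real.norm_eq_abs, sq_abs]
          simp only [boussinesqSystem]
          set ν := freq k with hν
          have hD : 0 < 1 + d * ν ^ 2 := by positivity
          have hk : 0 < 1 + (k : ℝ) ^ 2 := by positivity
          have h1 : 1 + (k : ℝ) ^ 2 ≤ (1 + 1 / d) * (1 + d * ν ^ 2) := by
            have := hmul ν one_pos hd
            rw [one_div_one] at this
            linarith [sq_le_freq_sq k]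
          have h2 : ν ^ 2 ≤ 1 / d * (1 + d * ν ^ 2) := by
            rw [mul_add, one_div, inv_mul_cancel_left₀ hd.ne']
            have : 0 < d⁻¹ := by positivity
            linarith
          have h3 := mul_le_mul h1 h2 (by positivity) (by positivity)
          rw [← div_eq_mul_inv, div_pow, mul_pow, div_le_div_iff₀ (by positivity) hk]
          calc l ^ 2 * ν ^ 2 * (1 + (k : ℝ) ^ 2) = l ^ 2 * ((1 + (k : ℝ) ^ 2) * ν ^ 2) := by ring
            _ ≤ l ^ 2 * ((1 + 1 / d) * (1 + d * ν ^ 2) * (1 / d * (1 + d * ν ^ 2))) := by gcongr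
            _ = l ^ 2 * ((1 + 1 / d) / d) * (1 + d * ν ^ 2) ^ 2 := by ring
      _ ≤ l ^ 2 * ((1 + 1 / d) / d) * S ^ 2 := by
          rw [← Finset.mul_sum]
          exact mul_le_mul_of_nonneg_left (hS s) (by positivity)

/-- Both the systems with `a = 0`, `c < 0` and those with `a < 0`, `c = 0` are dispersive systems
for one of the orders of the two unknowns. -/
theorem exists_dispersiveSystem {κ₁ κ₂ a b c d : ℝ} (l : ℝ) (hκ₁ : 0 < κ₁) (hκ₂ : 0 < κ₂)
    (hb : 0 < b) (hd : 0 < d) (hac : (a = 0 ∧ c < 0) ∨ (a < 0 ∧ c = 0)) :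
    ∃ (σ : DispersiveSystem) (C : ℝ), σ.Bounded C ∧ σ.Symmetric ∧
      ((∀ Z U, σ.rhsP Z U = zetaRhs κ₁ l a b Z U ∧ σ.rhsQ Z U = uRhs κ₂ l c d Z U) ∨
        ∀ Z U, σ.rhsP U Z = uRhs κ₂ l c d Z U ∧ σ.rhsQ U Z = zetaRhs κ₁ l a b Z U) := by
  rcases hac with ⟨rfl, hc⟩ | ⟨ha, rfl⟩
  -- Here `p = ζ`, `q = u` and `m = -c`; the nonlinearities `ζu` and `u²/2` are `p * q` and `q * q /
  -- 2`.
  · obtain ⟨C, hC⟩ := boussinesqSystem_bounded l 0 1 0 (1 / 2) hκ₁ hκ₂ (neg_pos.2 hc) hb hd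
    refine ⟨_, C, hC, boussinesqSystem_symmetric _ _ _ _ _ _ _ _ _ _,
      Or.inl fun Z U => ⟨?_, ?_⟩⟩
    · funext k
      simp [DispersiveSystem.rhsP, DispersiveSystem.F, zetaRhs, boussinesqSystem]
    · funext k
      have h := boussinesqSystem_W_sq_mul_α l 0 1 0 (1 / 2) hκ₁ hκ₂ (neg_pos.2 hc) hb hd k
      rw [DispersiveSystem.rhsQ, ← Complex.ofReal_pow, ← Complex.ofReal_mul, h]
      simp [DispersiveSystem.G, uRhs, boussinesqSystem, sub_eq_add_neg]
  -- Now `u` gains the derivative: `p = u`, `q = ζ`, `m = -a`, and `κ₁, κ₂` and `b, d` change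
  -- places. The nonlinearities become `p * p / 2` and `p * q`.
  · obtain ⟨C, hC⟩ := boussinesqSystem_bounded l (1 / 2) 0 1 0 hκ₂ hκ₁ (neg_pos.2 ha) hd hb
    refine ⟨_, C, hC, boussinesqSystem_symmetric _ _ _ _ _ _ _ _ _ _,
      Or.inr fun Z U => ⟨?_, ?_⟩⟩
    · funext k
      simp [DispersiveSystem.rhsP, DispersiveSystem.F, uRhs, boussinesqSystem]
    · funext k
      have h := boussinesqSystem_W_sq_mul_α l (1 / 2) 0 1 0 hκ₂ hκ₁ (neg_pos.2 ha) hd hb k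
      rw [DispersiveSystem.rhsQ, ← Complex.ofReal_pow, ← Complex.ofReal_mul, h]
      simp [DispersiveSystem.G, zetaRhs, boussinesqSystem, sub_eq_add_neg, conv_comm U Z]

/-! ### From the equations in physical space to Fourier space -/

theorem two_pi_I_mul_eq (k : ℤ) : (2 * Real.pi * Complex.I * k : ℂ) = Complex.I * (freq k : ℝ) := by
  rw [freq]
  push_cast
  ring

/-- The operator `1 - b ∂ₓ²` has the positive symbol `1 + bν²` and can be divided out. One statement
serves both equations, with `V` the coefficient of `ζu` or of `u²/2`. -/
theorem solve_for_derivative_iff {κ l a b : ℝ} (hb : 0 < b) (k : ℤ) (D U V : ℂ) :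
    D + κ * (2 * Real.pi * Complex.I * k * U) + l * (2 * Real.pi * Complex.I * k * V)
      + a * ((2 * Real.pi * Complex.I * k) ^ 3 * U) - b * ((2 * Real.pi * Complex.I * k) ^ 2 * D) = 0
    ↔ D = -Complex.I * ((freq k * (κ - a * freq k ^ 2) / (1 + b * freq k ^ 2) : ℝ) * U
      + (l * freq k / (1 + b * freq k ^ 2) : ℝ) * V) := by
  rw [two_pi_I_mul_eq]
  set x := freq k
  have hx : (1 + b * x ^ 2 : ℝ) ≠ 0 := by positivity
  have hx' : (1 + b * (x : ℂ) ^ 2) ≠ 0 := by exact_mod_cast hx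
  have hI : Complex.I ^ 3 = -Complex.I := Complex.I_pow_three
  push_cast
  rw [mul_pow, mul_pow, hI, Complex.I_sq]
  have e : -Complex.I * (x * (κ - a * (x : ℂ) ^ 2) / (1 + b * (x : ℂ) ^ 2) * U
      + l * x / (1 + b * (x : ℂ) ^ 2) * V)
      = -Complex.I * (x * (κ - a * (x : ℂ) ^ 2) * U + l * x * V) / (1 + b * (x : ℂ) ^ 2) := by
    ring
  rw [e, eq_div_iff hx']
  constructor <;> intro h <;> linear_combination h

/-- Exponentials are admissible test functions, and they turn the weak equations into equations for
single Fourier coefficients, with the convolution as nonlinear term. -/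
theorem IsSolution.hasDerivWithinAt_perCoeff {γ δ a b c d T μ : ℝ} {ζ₀ u₀ : PerSobolev μ}
    {ζ u : ℝ → PerSobolev μ} (h : IsSolution γ δ a b c d T μ ζ₀ u₀ ζ u) (hμ : 1 ≤ μ) (hb : 0 < b)
    (hd : 0 < d) {t : ℝ} (ht : t ∈ Icc 0 T) (k : ℤ) :
    HasDerivWithinAt (fun s => perCoeff (ζ s).toL2 k)
      (zetaRhs (kappa1 γ δ) (lam γ δ) a b (perCoeff (ζ t).toL2) (perCoeff (u t).toL2) k)
      (Icc 0 T) t ∧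
    HasDerivWithinAt (fun s => perCoeff (u s).toL2 k)
      (uRhs (kappa2 γ) (lam γ δ) ((1 - γ) * c) d (perCoeff (ζ t).toL2) (perCoeff (u t).toL2) k)
      (Icc 0 T) t := by
  constructor
  · convert! PerSobolev.hasDerivWithinAt_perCoeff hμ h.contDiffOn_zeta ht k using 1
    symm
    have e := h.eq_zeta t ht _ (contDiff_expMode k) (periodic_expMode k)
    rw [ip_iteratedDeriv_expMode, ip_iteratedDeriv_expMode, ip_deriv_expMode, ip_deriv_expMode,
      PerSobolev.ip_fn, PerSobolev.ip_fn, PerSobolev.ip_fn_mul] at e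
    rw [zetaRhs, ← solve_for_derivative_iff hb]
    linear_combination e
  · convert! PerSobolev.hasDerivWithinAt_perCoeff hμ h.contDiffOn_u ht k using 1
    symm
    have e := h.eq_u t ht _ (contDiff_expMode k) (periodic_expMode k)
    simp only [sq ((u t).fn _)] at e
    rw [ip_iteratedDeriv_expMode, ip_iteratedDeriv_expMode, ip_deriv_expMode, ip_deriv_expMode,
      PerSobolev.ip_fn, PerSobolev.ip_fn, PerSobolev.ip_fn_mul] at e
    rw [uRhs, ← solve_for_derivative_iff hd]
    push_cast
    linear_combination e

theorem ip_const_mul_left (r : ℝ) (f : ℝ → ℝ) (g : ℝ → ℂ) :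
    ip (fun x => r * f x) g = r * ip f g := by
  rw [ip, ip, ← intervalIntegral.integral_const_mul]
  congr 1
  funext x
  push_cast
  ring

/-- A Galerkin equation, tested with all of `S_N`, amounts to equations for the Fourier
coefficients. -/
theorem galerkin_equation_iff {κ l a b : ℝ} (hb : 0 < b) (N : ℕ) {f g p : ℝ → ℝ}
    (hf : ContDiff ℝ ∞ f) (hf' : Function.Periodic f 1) (hg : ContDiff ℝ ∞ g)
    (hg' : Function.Periodic g 1) (hp : ContDiff ℝ ∞ p) (hp' : Function.Periodic p 1) :
    (∀ φ ∈ trigSpace N, ip f φ + κ * ip (deriv g) φ + l * ip (deriv p) φ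
      + a * ip (iteratedDeriv 3 g) φ - b * ip (iteratedDeriv 2 f) φ = 0) ↔
    ∀ k ∈ Finset.Icc (-(N : ℤ)) N, ip f (expMode k)
      = -Complex.I * ((freq k * (κ - a * freq k ^ 2) / (1 + b * freq k ^ 2) : ℝ) * ip g (expMode k)
        + (l * freq k / (1 + b * freq k ^ 2) : ℝ) * ip p (expMode k)) := by
  simp only [← solve_for_derivative_iff hb]
  have key : ∀ k, ip f (expMode k) + κ * ip (deriv g) (expMode k) + l * ip (deriv p) (expMode k)
      + a * ip (iteratedDeriv 3 g) (expMode k) - b * ip (iteratedDeriv 2 f) (expMode k)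
      = ip f (expMode k) + κ * (2 * Real.pi * Complex.I * k * ip g (expMode k))
        + l * (2 * Real.pi * Complex.I * k * ip p (expMode k))
        + a * ((2 * Real.pi * Complex.I * k) ^ 3 * ip g (expMode k))
        - b * ((2 * Real.pi * Complex.I * k) ^ 2 * ip f (expMode k)) := by
    intro k
    rw [ip_deriv_left hg hg', ip_deriv_left hp hp', ip_iteratedDeriv_left hg hg',
      ip_iteratedDeriv_left hf hf']
  constructor
  · intro h k hk
    rw [← key]
    exact h _ (expMode_mem_trigSpace hk)
  · intro h φ hφ
    obtain ⟨e, rfl⟩ := mem_trigSpace_iff.1 hφ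
    rw [ip_trigSum_right hf.continuous, ip_trigSum_right (hg.continuous_deriv (by simp)),
      ip_trigSum_right (hp.continuous_deriv (by simp)),
      ip_trigSum_right (hg.continuous_iteratedDeriv 3 (WithTop.coe_le_coe.2 le_top)),
      ip_trigSum_right (hf.continuous_iteratedDeriv 2 (WithTop.coe_le_coe.2 le_top))]
    simp only [Finset.mul_sum, ← Finset.sum_add_distrib, ← Finset.sum_sub_distrib]
    refine Finset.sum_eq_zero fun k hk => ?_
    have := key k
    rw [h k hk] at this
    linear_combination conj (e k) * this

/-- The coefficients of the projection of `f` to `S_N`. -/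
noncomputable def trigCoeff (N : ℕ) (f : ℝ → ℝ) : ℤ → ℂ := lowPass N fun k => ip f (expMode k)

theorem trigCoeff_eq_zero (N : ℕ) (f : ℝ → ℝ) : ∀ k ∉ Finset.Icc (-(N : ℤ)) N, trigCoeff N f k = 0 :=
  fun _ hk => if_neg hk

theorem lowPass_lowPass (N : ℕ) (c : ℤ → ℂ) : lowPass N (lowPass N c) = lowPass N c :=
  DispersiveSystem.lowPass_eq_self fun _ hk => if_neg hk

theorem trigCoeff_of_eq_trigSum {N : ℕ} {c : ℤ → ℂ} {f : ℝ → ℝ}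
    (hf : ∀ x, (f x : ℂ) = trigSum N c x) : trigCoeff N f = lowPass N c := by
  unfold trigCoeff
  simp only [ip_trigSum hf]
  exact lowPass_lowPass N c

theorem eq_trigSum_trigCoeff {N : ℕ} {f : ℝ → ℝ} (hf : (fun x => (f x : ℂ)) ∈ trigSpace N) (x : ℝ) :
    (f x : ℂ) = trigSum N (trigCoeff N f) x := by
  obtain ⟨c, hc⟩ := mem_trigSpace_iff.1 hf
  rw [trigCoeff_of_eq_trigSum (congrFun hc), trigSum_lowPass]
  exact congrFun hc x

theorem hasDerivWithinAt_trigSum {N : ℕ} {c : ℝ → ℤ → ℂ} {c' : ℤ → ℂ} {s : Set ℝ} {t : ℝ}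
    (h : ∀ k ∈ Finset.Icc (-(N : ℤ)) N, HasDerivWithinAt (fun τ => c τ k) (c' k) s t) (x : ℝ) :
    HasDerivWithinAt (fun τ => trigSum N (c τ) x) (trigSum N c' x) s t :=
  HasDerivWithinAt.fun_sum fun k hk => (h k hk).mul_const _

/-- If a curve in `S_N` is differentiable pointwise, its coefficients are differentiable. -/
theorem hasDerivWithinAt_trigCoeff {T : ℝ} (hT : 0 < T) {N : ℕ} {f : ℝ → ℝ → ℝ}
    (hf : ∀ t ∈ Icc 0 T, (fun x => (f t x : ℂ)) ∈ trigSpace N)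
    (hd : ∀ x, DifferentiableOn ℝ (fun t => f t x) (Icc 0 T)) {t : ℝ} (ht : t ∈ Icc 0 T) :
    (∀ k, HasDerivWithinAt (fun s => trigCoeff N (f s) k) (trigCoeff N (timeDeriv T f t) k)
      (Icc 0 T) t) ∧
    ∀ x, (timeDeriv T f t x : ℂ) = trigSum N (trigCoeff N (timeDeriv T f t)) x := by
  have hfd : ∀ x, HasDerivWithinAt (fun s => (f s x : ℂ)) (timeDeriv T f t x) (Icc 0 T) t :=
    fun x => (hd x t ht).hasDerivWithinAt.ofReal_comp
  have hM : (2 * N + 1 : ℂ) ≠ 0 := by exact_mod_cast (Nat.succ_ne_zero (2 * N))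
  -- The coefficients are a fixed linear combination of the values at `2N + 1` equidistant points,
  -- so differentiability at each point passes to them.
  set c' : ℤ → ℂ := fun k => (2 * N + 1 : ℂ)⁻¹ * ∑ j ∈ Finset.range (2 * N + 1),
    (timeDeriv T f t (j / (2 * N + 1 : ℝ)) : ℂ) * expMode (-k) (j / (2 * N + 1 : ℝ)) with hc'
  have h1 : ∀ k ∈ Finset.Icc (-(N : ℤ)) N,
      HasDerivWithinAt (fun s => trigCoeff N (f s) k) (c' k) (Icc 0 T) t := by
    intro k hk
    have e : ∀ s ∈ Icc 0 T, trigCoeff N (f s) k = (2 * N + 1 : ℂ)⁻¹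
        * ∑ j ∈ Finset.range (2 * N + 1),
          (f s (j / (2 * N + 1 : ℝ)) : ℂ) * expMode (-k) (j / (2 * N + 1 : ℝ)) := by
      intro s hs
      simp only [eq_trigSum_trigCoeff (hf s hs)]
      rw [sum_trigSum_mul_expMode N _ hk, inv_mul_cancel_left₀ hM]
    exact HasDerivWithinAt.congr
      ((HasDerivWithinAt.fun_sum fun j _ => (hfd _).mul_const _).const_mul _) e (e t ht)
  -- Differentiating the finite sum gives a second expression for the derivative; the two agree
  -- since `[0, T]` is nondegenerate. Hence the time derivative lies in `S_N` as well.
  have h2 : ∀ x, (timeDeriv T f t x : ℂ) = trigSum N c' x := by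
    intro x
    have h3 := (hasDerivWithinAt_trigSum h1 x).congr (fun s hs => eq_trigSum_trigCoeff (hf s hs) x)
      (eq_trigSum_trigCoeff (hf t ht) x)
    exact (uniqueDiffOn_Icc hT t ht).eq_deriv _ (hfd x) h3
  have h4 := trigCoeff_of_eq_trigSum h2
  refine ⟨fun k => ?_, fun x => ?_⟩
  · rw [h4]
    by_cases hk : k ∈ Finset.Icc (-(N : ℤ)) N
    · rw [lowPass, if_pos hk]
      exact h1 k hk
    · simp only [trigCoeff, lowPass, hk, if_false]
      exact hasDerivWithinAt_const _ _ _
  · rw [h4, trigSum_lowPass]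
    exact h2 x

/-- The semidiscrete system for the Fourier coefficients. -/
structure IsFourierGalerkin (κ₁ κ₂ l a b c d T : ℝ) (N : ℕ) (z w : ℝ → ℤ → ℂ) : Prop where
  z_eq_zero : ∀ t ∈ Icc 0 T, ∀ k ∉ Finset.Icc (-(N : ℤ)) N, z t k = 0
  w_eq_zero : ∀ t ∈ Icc 0 T, ∀ k ∉ Finset.Icc (-(N : ℤ)) N, w t k = 0
  deriv_z : ∀ t ∈ Icc 0 T, ∀ k ∈ Finset.Icc (-(N : ℤ)) N,
    HasDerivWithinAt (fun s => z s k) (zetaRhs κ₁ l a b (z t) (w t) k) (Icc 0 T) t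
  deriv_w : ∀ t ∈ Icc 0 T, ∀ k ∈ Finset.Icc (-(N : ℤ)) N,
    HasDerivWithinAt (fun s => w s k) (uRhs κ₂ l c d (z t) (w t) k) (Icc 0 T) t

theorem mul_deriv_eq_deriv_half_sq {f : ℝ → ℝ} (hf : ContDiff ℝ ∞ f) :
    (fun x => f x * deriv f x) = deriv fun x => 1 / 2 * (f x * f x) := by
  funext x
  have h : HasDerivAt f (deriv f x) x := (hf.differentiable (by simp)).differentiableAt.hasDerivAt
  rw [((h.fun_mul h).const_mul (1 / 2)).deriv]
  ring

/-- The semidiscrete equations, for trigonometric polynomials with given coefficients. -/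
theorem semidiscrete_equations_iff {κ₁ κ₂ l a b c d : ℝ} (hb : 0 < b) (hd : 0 < d) {N : ℕ}
    {f g f' g' : ℝ → ℝ} {z w z' w' : ℤ → ℂ} (hf : ∀ x, (f x : ℂ) = trigSum N z x)
    (hg : ∀ x, (g x : ℂ) = trigSum N w x) (hf' : ∀ x, (f' x : ℂ) = trigSum N z' x)
    (hg' : ∀ x, (g' x : ℂ) = trigSum N w' x)
    (hz : ∀ k ∉ Finset.Icc (-(N : ℤ)) N, z k = 0) (hw : ∀ k ∉ Finset.Icc (-(N : ℤ)) N, w k = 0) :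
    ((∀ φ ∈ trigSpace N, ip f' φ + κ₁ * ip (deriv g) φ + l * ip (deriv fun x => f x * g x) φ
        + a * ip (iteratedDeriv 3 g) φ - b * ip (iteratedDeriv 2 f') φ = 0) ↔
      ∀ k ∈ Finset.Icc (-(N : ℤ)) N, z' k = zetaRhs κ₁ l a b z w k) ∧
    ((∀ φ ∈ trigSpace N, ip g' φ + κ₂ * ip (deriv f) φ + l * ip (fun x => g x * deriv g x) φ
        + c * ip (iteratedDeriv 3 f) φ - d * ip (iteratedDeriv 2 g') φ = 0) ↔
      ∀ k ∈ Finset.Icc (-(N : ℤ)) N, w' k = uRhs κ₂ l c d z w k) := by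
  have cf := contDiff_of_ofReal_eq_trigSum hf
  have cg := contDiff_of_ofReal_eq_trigSum hg
  have cf' := contDiff_of_ofReal_eq_trigSum hf'
  have cg' := contDiff_of_ofReal_eq_trigSum hg'
  have pf := periodic_of_ofReal_eq_trigSum hf
  have pg := periodic_of_ofReal_eq_trigSum hg
  have pf' := periodic_of_ofReal_eq_trigSum hf'
  have pg' := periodic_of_ofReal_eq_trigSum hg'
  have hz' := DispersiveSystem.lowPass_eq_self hz
  have hw' := DispersiveSystem.lowPass_eq_self hw
  constructor
  · rw [galerkin_equation_iff hb N cf' pf' cg pg (cf.mul cg) (pf.mul pg)]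
    refine forall₂_congr fun k hk => ?_
    rw [ip_mul_trigSum hf hg, ip_trigSum hf', ip_trigSum hg, hz', hw', lowPass, if_pos hk]
    rfl
  · have cs : ContDiff ℝ ∞ fun x => 1 / 2 * (g x * g x) := contDiff_const.mul (cg.mul cg)
    have ps : Function.Periodic (fun x => 1 / 2 * (g x * g x)) 1 := by
      intro x
      simp only [pg x]
    rw [mul_deriv_eq_deriv_half_sq cg, galerkin_equation_iff hd N cg' pg' cf pf cs ps]
    refine forall₂_congr fun k hk => ?_
    rw [ip_const_mul_left, ip_mul_trigSum hg hg, ip_trigSum hf, ip_trigSum hg', hz', hw', lowPass,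
      if_pos hk, uRhs]
    push_cast
    rfl

theorem trigProj_eq_trigSum (N : ℕ) {μ : ℝ} (v : PerSobolev μ) :
    trigProj N v = trigSum N (perCoeff v.toL2) := rfl

theorem IsSemidiscreteSolution.isFourierGalerkin {γ δ a b c d T μ : ℝ} {ζ₀ u₀ : PerSobolev μ}
    {N : ℕ} {ζN uN : ℝ → ℝ → ℝ} (hT : 0 < T) (hb : 0 < b) (hd : 0 < d)
    (h : IsSemidiscreteSolution γ δ a b c d T μ ζ₀ u₀ N ζN uN) :
    IsFourierGalerkin (kappa1 γ δ) (kappa2 γ) (lam γ δ) a b ((1 - γ) * c) d T N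
      (fun t => trigCoeff N (ζN t)) (fun t => trigCoeff N (uN t)) := by
  have key := fun t ht => semidiscrete_equations_iff (κ₁ := kappa1 γ δ) (κ₂ := kappa2 γ)
    (l := lam γ δ) (a := a) (c := (1 - γ) * c) hb hd (eq_trigSum_trigCoeff (h.mem_zeta t ht))
    (eq_trigSum_trigCoeff (h.mem_u t ht))
    (hasDerivWithinAt_trigCoeff hT h.mem_zeta h.diff_zeta ht).2
    (hasDerivWithinAt_trigCoeff hT h.mem_u h.diff_u ht).2
    (trigCoeff_eq_zero N _) (trigCoeff_eq_zero N _)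
  refine ⟨fun t _ => trigCoeff_eq_zero N _, fun t _ => trigCoeff_eq_zero N _,
    fun t ht k hk => ?_, fun t ht k hk => ?_⟩
  · rw [← (key t ht).1.1 (h.eq_zeta t ht) k hk]
    exact (hasDerivWithinAt_trigCoeff hT h.mem_zeta h.diff_zeta ht).1 k
  · have e := h.eq_u t ht
    push_cast at key
    rw [← (key t ht).2.1 e k hk]
    exact (hasDerivWithinAt_trigCoeff hT h.mem_u h.diff_u ht).1 k

/-- Under `k ↦ -k` the sum goes over into its conjugate, so taking real parts loses nothing. -/
theorem ofReal_re_trigSum {N : ℕ} {c : ℤ → ℂ} (hc : ∀ k, conj (c (-k)) = c k) (x : ℝ) :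
    (((trigSum N c x).re : ℝ) : ℂ) = trigSum N c x := by
  rw [← Complex.conj_eq_iff_re, trigSum, map_sum]
  refine Finset.sum_nbij' (fun k => -k) (fun k => -k) ?_ ?_ ?_ ?_ ?_
  · intro k hk
    simp only [Finset.mem_Icc] at hk ⊢
    omega
  · intro k hk
    simp only [Finset.mem_Icc] at hk ⊢
    omega
  · intro k _
    exact neg_neg k
  · intro k _
    exact neg_neg k
  · intro k _
    rw [map_mul, conj_expMode, ← hc (-k), neg_neg]

theorem IsFourierGalerkin.isSemidiscreteSolution {γ δ a b c d T μ : ℝ} {ζ₀ u₀ : PerSobolev μ}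
    {N : ℕ} {z w : ℝ → ℤ → ℂ} (hT : 0 < T) (hb : 0 < b) (hd : 0 < d)
    (h : IsFourierGalerkin (kappa1 γ δ) (kappa2 γ) (lam γ δ) a b ((1 - γ) * c) d T N z w)
    (hz0 : z 0 = lowPass N (perCoeff ζ₀.toL2)) (hw0 : w 0 = lowPass N (perCoeff u₀.toL2))
    (hz : ∀ t ∈ Icc 0 T, ∀ k, conj (z t (-k)) = z t k)
    (hw : ∀ t ∈ Icc 0 T, ∀ k, conj (w t (-k)) = w t k) :
    IsSemidiscreteSolution γ δ a b c d T μ ζ₀ u₀ N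
      (fun t x => (trigSum N (z t) x).re) (fun t x => (trigSum N (w t) x).re) := by
  have h0 : (0 : ℝ) ∈ Icc 0 T := left_mem_Icc.2 hT.le
  have hmz : ∀ t ∈ Icc 0 T, (fun x => (((trigSum N (z t) x).re : ℝ) : ℂ)) ∈ trigSpace N :=
    fun t ht => mem_trigSpace_iff.2 ⟨z t, funext (ofReal_re_trigSum (hz t ht))⟩
  have hmw : ∀ t ∈ Icc 0 T, (fun x => (((trigSum N (w t) x).re : ℝ) : ℂ)) ∈ trigSpace N :=
    fun t ht => mem_trigSpace_iff.2 ⟨w t, funext (ofReal_re_trigSum (hw t ht))⟩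
  have hdz : ∀ x, DifferentiableOn ℝ (fun t => (trigSum N (z t) x).re) (Icc 0 T) := by
    intro x t ht
    exact ((Complex.reCLM.hasFDerivAt.comp_hasDerivWithinAt t
      (hasDerivWithinAt_trigSum (h.deriv_z t ht) x))).differentiableWithinAt
  have hdw : ∀ x, DifferentiableOn ℝ (fun t => (trigSum N (w t) x).re) (Icc 0 T) := by
    intro x t ht
    exact ((Complex.reCLM.hasFDerivAt.comp_hasDerivWithinAt t
      (hasDerivWithinAt_trigSum (h.deriv_w t ht) x))).differentiableWithinAt
  have ez : ∀ t ∈ Icc 0 T, trigCoeff N (fun x => (trigSum N (z t) x).re) = z t := by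
    intro t ht
    rw [trigCoeff_of_eq_trigSum (ofReal_re_trigSum (hz t ht)),
      DispersiveSystem.lowPass_eq_self (h.z_eq_zero t ht)]
  have ew : ∀ t ∈ Icc 0 T, trigCoeff N (fun x => (trigSum N (w t) x).re) = w t := by
    intro t ht
    rw [trigCoeff_of_eq_trigSum (ofReal_re_trigSum (hw t ht)),
      DispersiveSystem.lowPass_eq_self (h.w_eq_zero t ht)]
  have key := fun t ht => semidiscrete_equations_iff (κ₁ := kappa1 γ δ) (κ₂ := kappa2 γ)
    (l := lam γ δ) (a := a) (c := (1 - γ) * c) hb hd (ofReal_re_trigSum (hz t ht))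
    (ofReal_re_trigSum (hw t ht)) (hasDerivWithinAt_trigCoeff hT hmz hdz ht).2
    (hasDerivWithinAt_trigCoeff hT hmw hdw ht).2 (h.z_eq_zero t ht) (h.w_eq_zero t ht)
  refine ⟨hmz, hmw, hdz, hdw, fun t ht => ?_, fun t ht => ?_, fun x => ?_, fun x => ?_⟩
  · refine (key t ht).1.2 fun k hk => ?_
    exact (uniqueDiffOn_Icc hT t ht).eq_deriv _
      (((hasDerivWithinAt_trigCoeff hT hmz hdz ht).1 k).congr
        (fun s hs => by rw [ez s hs]) (by rw [ez t ht])) (h.deriv_z t ht k hk)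
  · have := (key t ht).2.2 fun k hk => (uniqueDiffOn_Icc hT t ht).eq_deriv _
      (((hasDerivWithinAt_trigCoeff hT hmw hdw ht).1 k).congr
        (fun s hs => by rw [ew s hs]) (by rw [ew t ht])) (h.deriv_w t ht k hk)
    push_cast at this
    exact this
  · rw [ofReal_re_trigSum (hz 0 h0), hz0, trigSum_lowPass, trigProj_eq_trigSum]
  · rw [ofReal_re_trigSum (hw 0 h0), hw0, trigSum_lowPass, trigProj_eq_trigSum]

/-! ### The error estimate -/

section

variable {κ₁ κ₂ l a b c d T : ℝ} {N : ℕ} {z w : ℝ → ℤ → ℂ}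

theorem isFourierGalerkin_iff {σ : DispersiveSystem}
    (h : ∀ Z U, σ.rhsP Z U = zetaRhs κ₁ l a b Z U ∧ σ.rhsQ Z U = uRhs κ₂ l c d Z U) :
    IsFourierGalerkin κ₁ κ₂ l a b c d T N z w ↔ σ.IsGalerkin T N z w := by
  constructor
  · rintro ⟨h1, h2, h3, h4⟩
    refine ⟨h1, h2, ?_, ?_⟩ <;> simpa only [h]
  · rintro ⟨h1, h2, h3, h4⟩
    simp only [h] at h3 h4
    exact ⟨h1, h2, h3, h4⟩

theorem isFourierGalerkin_iff_swap {σ : DispersiveSystem}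
    (h : ∀ Z U, σ.rhsP U Z = uRhs κ₂ l c d Z U ∧ σ.rhsQ U Z = zetaRhs κ₁ l a b Z U) :
    IsFourierGalerkin κ₁ κ₂ l a b c d T N z w ↔ σ.IsGalerkin T N w z := by
  constructor
  · rintro ⟨h1, h2, h3, h4⟩
    refine ⟨h2, h1, ?_, ?_⟩ <;> simpa only [h]
  · rintro ⟨h1, h2, h3, h4⟩
    simp only [h] at h3 h4
    exact ⟨h2, h1, h4, h3⟩

theorem IsFourierGalerkin.unique (hκ₁ : 0 < κ₁) (hκ₂ : 0 < κ₂) (hb : 0 < b) (hd : 0 < d)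
    (hac : (a = 0 ∧ c < 0) ∨ (a < 0 ∧ c = 0)) {z' w' : ℝ → ℤ → ℂ}
    (h : IsFourierGalerkin κ₁ κ₂ l a b c d T N z w)
    (h' : IsFourierGalerkin κ₁ κ₂ l a b c d T N z' w') (hz : z 0 = z' 0) (hw : w 0 = w' 0) :
    ∀ t ∈ Icc 0 T, z t = z' t ∧ w t = w' t := by
  obtain ⟨σ, C, hC, -, hσ | hσ⟩ := exists_dispersiveSystem l hκ₁ hκ₂ hb hd hac
  · rw [isFourierGalerkin_iff hσ] at h h'
    exact h.unique hC.W_pos h' hz hw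
  · rw [isFourierGalerkin_iff_swap hσ] at h h'
    exact fun t ht => (h.unique hC.W_pos h' hw hz t ht).symm

/-- Existence of the semidiscrete approximation in Fourier space, with an error estimate. -/
theorem exists_isFourierGalerkin (hκ₁ : 0 < κ₁) (hκ₂ : 0 < κ₂) (hb : 0 < b) (hd : 0 < d)
    (hac : (a = 0 ∧ c < 0) ∨ (a < 0 ∧ c = 0)) (hT : 0 ≤ T) {M : ℝ} {Z U : ℝ → ℤ → ℂ}
    (hZU : ∀ t ∈ Icc 0 T, ∀ k,
      HasDerivWithinAt (fun s => Z s k) (zetaRhs κ₁ l a b (Z t) (U t) k) (Icc 0 T) t ∧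
      HasDerivWithinAt (fun s => U s k) (uRhs κ₂ l c d (Z t) (U t) k) (Icc 0 T) t)
    (hZ : ∀ t ∈ Icc 0 T, EllOneLe (Z t) M) (hU : ∀ t ∈ Icc 0 T, EllOneLe (U t) M)
    (hZ0 : ∀ k, conj (Z 0 (-k)) = Z 0 k) (hU0 : ∀ k, conj (U 0 (-k)) = U 0 k) :
    ∃ D : ℝ, 0 < D ∧ ∀ (N : ℕ) (ε : ℝ),
      (∀ t ∈ Icc 0 T, EllTwoLe (lowPass N (Z t) - Z t) ε) →
      (∀ t ∈ Icc 0 T, EllTwoLe (lowPass N (U t) - U t) ε) → D * ε ≤ 1 →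
      ∃ z w : ℝ → ℤ → ℂ, IsFourierGalerkin κ₁ κ₂ l a b c d T N z w ∧
        z 0 = lowPass N (Z 0) ∧ w 0 = lowPass N (U 0) ∧
        ∀ t ∈ Icc 0 T, (∀ k, conj (z t (-k)) = z t k) ∧ (∀ k, conj (w t (-k)) = w t k) ∧
          EllTwoLe (z t - Z t) (D * ε) ∧ EllTwoLe (w t - U t) (D * ε) := by
  have hlow : ∀ (N : ℕ) (f : ℤ → ℂ), (∀ k, conj (f (-k)) = f k) →
      ∀ k, conj (lowPass N f (-k)) = lowPass N f k := by
    intro N f hf k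
    have hneg : -k ∈ Finset.Icc (-(N : ℤ)) N ↔ k ∈ Finset.Icc (-(N : ℤ)) N := by
      simp only [Finset.mem_Icc]
      omega
    by_cases hk : k ∈ Finset.Icc (-(N : ℤ)) N
    · rw [lowPass, lowPass, if_pos hk, if_pos (hneg.2 hk), hf]
    · rw [lowPass, lowPass, if_neg hk, if_neg (hneg.not.2 hk), map_zero]
  obtain ⟨σ, C, hC, hs, hσ | hσ⟩ := exists_dispersiveSystem l hκ₁ hκ₂ hb hd hac
  · have hex : σ.IsExact T Z U := by
      intro t ht k
      rw [(hσ _ _).1, (hσ _ _).2]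
      exact hZU t ht k
    obtain ⟨D, hD, h⟩ := hex.exists_isGalerkin hC hT hZ hU
    refine ⟨D, hD, fun N ε h1 h2 h3 => ?_⟩
    obtain ⟨z, w, hG, hz0, hw0, hest⟩ := h N ε h1 h2 h3
    have hconj := hG.conj_eq hC.W_pos hs (hz0 ▸ hlow N _ hZ0) (hw0 ▸ hlow N _ hU0)
    exact ⟨z, w, (isFourierGalerkin_iff hσ).2 hG, hz0, hw0, fun t ht =>
      ⟨(hconj t ht).1, (hconj t ht).2, hest t ht⟩⟩
  · have hex : σ.IsExact T U Z := by
      intro t ht k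
      rw [(hσ _ _).1, (hσ _ _).2]
      exact (hZU t ht k).symm
    obtain ⟨D, hD, h⟩ := hex.exists_isGalerkin hC hT hU hZ
    refine ⟨D, hD, fun N ε h1 h2 h3 => ?_⟩
    obtain ⟨w, z, hG, hw0, hz0, hest⟩ := h N ε h2 h1 h3
    have hconj := hG.conj_eq hC.W_pos hs (hw0 ▸ hlow N _ hU0) (hz0 ▸ hlow N _ hZ0)
    exact ⟨z, w, (isFourierGalerkin_iff_swap hσ).2 hG, hz0, hw0, fun t ht =>
      ⟨(hconj t ht).2, (hconj t ht).1, (hest t ht).symm⟩⟩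

end

/-- The `L²` distance of a trigonometric polynomial to an element of `H^μ`. -/
theorem l2norm_sub_fn_le {N : ℕ} {c : ℤ → ℂ} {f : ℝ → ℝ} (hf : ∀ x, (f x : ℂ) = trigSum N c x)
    {μ : ℝ} (v : PerSobolev μ) {K : ℝ} (h : EllTwoLe (lowPass N c - perCoeff v.toL2) K) :
    l2norm (fun x => f x - v.fn x) ≤ K := by
  have hfc : Continuous f := (contDiff_of_ofReal_eq_trigSum hf).continuous
  have hv : IntervalIntegrable (fun x => (v.fn x : ℂ)) volume 0 1 :=
    (intervalIntegrable_iff_integrableOn_Ioc_of_le zero_le_one).2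
      ((v.memLp_fn.integrable one_le_two).ofReal)
  obtain ⟨B, hB⟩ := (isCompact_Icc (a := (0 : ℝ)) (b := 1)).exists_bound_of_continuousOn
    hfc.continuousOn
  have hfm : MemLp f 2 (volume.restrict (Ioc 0 1)) :=
    MemLp.of_bound hfc.aestronglyMeasurable B
      ((ae_restrict_mem measurableSet_Ioc).mono fun x hx => hB x (Ioc_subset_Icc_self hx))
  refine l2norm_le_of_ellTwoLe (hfm.sub v.memLp_fn) (h.of_norm_le fun k => le_of_eq ?_)
  have hc : Continuous (expMode (-k)) := (contDiff_expMode (-k)).continuous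
  have hcf : Continuous fun x => expMode (-k) x * (f x : ℂ) :=
    hc.mul (Complex.continuous_ofReal.comp hfc)
  rw [Pi.sub_apply, ← ip_trigSum hf, ← v.ip_fn, ip_expMode, ip_expMode, ip_expMode,
    ← intervalIntegral.integral_sub (hcf.intervalIntegrable _ _)
      (hv.continuousOn_mul hc.continuousOn)]
  simp only [Pi.sub_apply, Complex.ofReal_sub, mul_sub]

section

variable {γ δ a b c d T μ : ℝ} {ζ₀ u₀ : PerSobolev μ} {N : ℕ} {ζN uN : ℝ → ℝ → ℝ}

theorem kappa1_pos (hγ : 0 ≤ γ) (hδ : 0 < δ) : 0 < kappa1 γ δ := by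
  rw [kappa1]
  positivity

theorem kappa2_pos (hγ : γ < 1) : 0 < kappa2 γ := sub_pos.2 hγ

theorem scaled_c_cases (hγ : γ < 1) (hac : (a = 0 ∧ c < 0) ∨ (a < 0 ∧ c = 0)) :
    (a = 0 ∧ (1 - γ) * c < 0) ∨ (a < 0 ∧ (1 - γ) * c = 0) := by
  rcases hac with ⟨ha, hc⟩ | ⟨ha, hc⟩
  · exact Or.inl ⟨ha, mul_neg_of_pos_of_neg (sub_pos.2 hγ) hc⟩
  · exact Or.inr ⟨ha, by rw [hc, mul_zero]⟩

/-- Uniqueness of the semidiscrete solution. -/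
theorem IsSemidiscreteSolution.unique (hγ0 : 0 ≤ γ) (hγ1 : γ < 1) (hδ : 0 < δ) (hb : 0 < b)
    (hd : 0 < d) (hac : (a = 0 ∧ c < 0) ∨ (a < 0 ∧ c = 0)) (hT : 0 < T) {ζN' uN' : ℝ → ℝ → ℝ}
    (h : IsSemidiscreteSolution γ δ a b c d T μ ζ₀ u₀ N ζN uN)
    (h' : IsSemidiscreteSolution γ δ a b c d T μ ζ₀ u₀ N ζN' uN') :
    ∀ t ∈ Icc 0 T, ζN t = ζN' t ∧ uN t = uN' t := by
  intro t ht
  have hu := (h.isFourierGalerkin hT hb hd).unique (kappa1_pos hγ0 hδ) (kappa2_pos hγ1) hb hd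
    (scaled_c_cases hγ1 hac) (h'.isFourierGalerkin hT hb hd)
    (by rw [trigCoeff_of_eq_trigSum h.init_zeta, trigCoeff_of_eq_trigSum h'.init_zeta])
    (by rw [trigCoeff_of_eq_trigSum h.init_u, trigCoeff_of_eq_trigSum h'.init_u]) t ht
  constructor
  · funext x
    apply Complex.ofReal_injective
    rw [eq_trigSum_trigCoeff (h.mem_zeta t ht), eq_trigSum_trigCoeff (h'.mem_zeta t ht), hu.1]
  · funext x
    apply Complex.ofReal_injective
    rw [eq_trigSum_trigCoeff (h.mem_u t ht), eq_trigSum_trigCoeff (h'.mem_u t ht), hu.2]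

/-- A crude bound by compactness of `[0, T]`, with a constant depending on the solution and on `N`.
It serves the finitely many `N` for which the estimate with a rate is not available. -/
theorem exists_l2norm_sub_fn_le {f : ℝ → ℝ → ℝ} {v : ℝ → PerSobolev μ} (hμ : 1 ≤ μ) (hT : 0 < T)
    (hf : ∀ t ∈ Icc 0 T, (fun x => (f t x : ℂ)) ∈ trigSpace N)
    (hd : ∀ x, DifferentiableOn ℝ (fun t => f t x) (Icc 0 T)) (hv : ContinuousOn v (Icc 0 T)) :
    ∃ K, ∀ t ∈ Icc 0 T, l2norm (fun x => f t x - (v t).fn x) ≤ K := by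
  obtain ⟨M, hM⟩ := isCompact_Icc.exists_bound_of_continuousOn hv
  have hc : ContinuousOn (fun t => ∑ k ∈ Finset.Icc (-(N : ℤ)) N, ‖trigCoeff N (f t) k‖)
      (Icc 0 T) := by
    refine continuousOn_finsetSum _ fun k _ => ContinuousOn.norm fun t ht => ?_
    exact ((hasDerivWithinAt_trigCoeff hT hf hd ht).1 k).continuousWithinAt
  obtain ⟨B, hB⟩ := isCompact_Icc.exists_bound_of_continuousOn hc
  refine ⟨B + M, fun t ht => l2norm_sub_fn_le (eq_trigSum_trigCoeff (hf t ht)) (v t) ?_⟩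
  rw [DispersiveSystem.lowPass_eq_self (trigCoeff_eq_zero N _)]
  have h1 : EllOneLe (trigCoeff N (f t)) B := by
    intro s
    refine le_trans ?_ ((Real.le_norm_self _).trans (hB t ht))
    calc ∑ k ∈ s, ‖trigCoeff N (f t) k‖
        ≤ ∑ k ∈ s ∪ Finset.Icc (-(N : ℤ)) N, ‖trigCoeff N (f t) k‖ :=
          Finset.sum_le_sum_of_subset_of_nonneg Finset.subset_union_left fun _ _ _ => norm_nonneg _
      _ = ∑ k ∈ Finset.Icc (-(N : ℤ)) N, ‖trigCoeff N (f t) k‖ := by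
          symm
          apply Finset.sum_subset Finset.subset_union_right
          intro k _ hk
          rw [trigCoeff_eq_zero N _ k hk, norm_zero]
  have h2 : EllTwoLe (-perCoeff (v t).toL2) M :=
    (((v t).ellTwoLe_perCoeff hμ).mono (hM t ht)).of_norm_le fun k => by simp
  rw [sub_eq_add_neg]
  exact h1.ellTwoLe.add h2

/-- Existence of the semidiscrete solution on `[0, T]` for large `N`, with the optimal order error
estimate in `L²`. -/
theorem IsSolution.exists_semidiscrete (hγ0 : 0 ≤ γ) (hγ1 : γ < 1) (hδ : 0 < δ) (hb : 0 < b)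
    (hd : 0 < d) (hac : (a = 0 ∧ c < 0) ∨ (a < 0 ∧ c = 0)) (hT : 0 < T) (hμ : 1 ≤ μ)
    {ζ u : ℝ → PerSobolev μ} (h : IsSolution γ δ a b c d T μ ζ₀ u₀ ζ u) :
    ∃ (N₀ : ℕ) (C : ℝ), 0 ≤ C ∧ ∀ N : ℕ, N₀ ≤ N → ∃ ζN uN : ℝ → ℝ → ℝ,
      IsSemidiscreteSolution γ δ a b c d T μ ζ₀ u₀ N ζN uN ∧ ∀ t ∈ Icc 0 T,
        l2norm (fun x => ζN t x - (ζ t).fn x) + l2norm (fun x => uN t x - (u t).fn x)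
          ≤ C * (N : ℝ) ^ (-μ) := by
  obtain ⟨S, hS0, hS⟩ := PerSobolev.exists_ellOneLe_perCoeff hμ
  obtain ⟨M₁, hM₁⟩ := isCompact_Icc.exists_bound_of_continuousOn h.contDiffOn_zeta.continuousOn
  obtain ⟨M₂, hM₂⟩ := isCompact_Icc.exists_bound_of_continuousOn h.contDiffOn_u.continuousOn
  set M := max M₁ M₂ with hM
  have hMz : ∀ t ∈ Icc 0 T, ‖ζ t‖ ≤ M := fun t ht => (hM₁ t ht).trans (le_max_left _ _)
  have hMu : ∀ t ∈ Icc 0 T, ‖u t‖ ≤ M := fun t ht => (hM₂ t ht).trans (le_max_right _ _)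
  have h0 : (0 : ℝ) ∈ Icc 0 T := left_mem_Icc.2 hT.le
  have hM0 : 0 ≤ M := (norm_nonneg _).trans (hMz 0 h0)
  have hreal : ∀ (f : L2Per) (k : ℤ), conj (perCoeff f (-k)) = perCoeff f k := by
    intro f k
    rw [conj_perCoeff, neg_neg]
  obtain ⟨D, hD, hex⟩ := exists_isFourierGalerkin (M := S * M)
    (Z := fun t => perCoeff (ζ t).toL2) (U := fun t => perCoeff (u t).toL2)
    (kappa1_pos hγ0 hδ) (kappa2_pos hγ1) hb hd (scaled_c_cases hγ1 hac) hT.le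
    (fun t ht k => h.hasDerivWithinAt_perCoeff hμ hb hd ht k)
    (fun t ht => (hS (ζ t)).mono (mul_le_mul_of_nonneg_left (hMz t ht) hS0))
    (fun t ht => (hS (u t)).mono (mul_le_mul_of_nonneg_left (hMu t ht) hS0))
    (hreal _) (hreal _)
  -- The truncation error is `ε = N^(-μ) M`; the smallness condition `D ε ≤ 1` thus holds from some
  -- `N₀` on.
  have hlim : Filter.Tendsto (fun N : ℕ => D * ((N : ℝ) ^ (-μ) * M)) Filter.atTop (nhds 0) := by
    have := (((tendsto_rpow_neg_atTop (show 0 < μ by linarith)).comp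
      tendsto_natCast_atTop_atTop).mul_const M).const_mul D
    simpa using this
  obtain ⟨N₀, hN₀⟩ := Filter.eventually_atTop.1 (hlim.eventually_le_const zero_lt_one)
  -- The truncation estimate needs `N ≥ 1`; the factor `2` counts the two unknowns.
  refine ⟨max N₀ 1, 2 * (D * M), by positivity, fun N hN => ?_⟩
  have hN1 : 1 ≤ N := (le_max_right _ _).trans hN
  have hNpos : (0 : ℝ) ≤ (N : ℝ) ^ (-μ) := by positivity
  obtain ⟨z, w, hG, hz0, hw0, hest⟩ := hex N ((N : ℝ) ^ (-μ) * M)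
    (fun t ht => ((ζ t).ellTwoLe_lowPass_sub hμ hN1).mono
      (mul_le_mul_of_nonneg_left (hMz t ht) hNpos))
    (fun t ht => ((u t).ellTwoLe_lowPass_sub hμ hN1).mono
      (mul_le_mul_of_nonneg_left (hMu t ht) hNpos))
    (hN₀ N ((le_max_left _ _).trans hN))
  simp only [h.init_zeta, h.init_u] at hz0 hw0
  refine ⟨_, _, hG.isSemidiscreteSolution hT hb hd hz0 hw0 (fun t ht => (hest t ht).1)
    (fun t ht => (hest t ht).2.1), fun t ht => ?_⟩
  obtain ⟨hz, hw, hez, hew⟩ := hest t ht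
  have e1 := l2norm_sub_fn_le (ofReal_re_trigSum hz) (ζ t)
    (by rwa [DispersiveSystem.lowPass_eq_self (hG.z_eq_zero t ht)])
  have e2 := l2norm_sub_fn_le (ofReal_re_trigSum hw) (u t)
    (by rwa [DispersiveSystem.lowPass_eq_self (hG.w_eq_zero t ht)])
  linarith

end

theorem mainTheorem5 (γ δ a b c d T μ : ℝ)
    (hγ0 : 0 ≤ γ) (hγ1 : γ < 1) (hδ : 0 < δ)
    (hb : 0 < b) (hd : 0 < d) (hac : (a = 0 ∧ c < 0) ∨ (a < 0 ∧ c = 0))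
    (hT : 0 < T) (hμ : 1 ≤ μ)
    (ζ₀ u₀ : PerSobolev μ) (ζ u : ℝ → PerSobolev μ)
    (hsol : IsSolution γ δ a b c d T μ ζ₀ u₀ ζ u) :
    (∃ N₀ : ℕ, ∀ N : ℕ, N₀ ≤ N → ∃ ζN uN : ℝ → ℝ → ℝ,
      IsSemidiscreteSolution γ δ a b c d T μ ζ₀ u₀ N ζN uN) ∧
    (∀ N : ℕ, 1 ≤ N → ∀ ζN uN ζN' uN' : ℝ → ℝ → ℝ,
      IsSemidiscreteSolution γ δ a b c d T μ ζ₀ u₀ N ζN uN →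
      IsSemidiscreteSolution γ δ a b c d T μ ζ₀ u₀ N ζN' uN' →
      ∀ t ∈ Set.Icc 0 T, ζN t = ζN' t ∧ uN t = uN' t) ∧
    (∃ C : ℝ, 0 < C ∧ ∀ N : ℕ, 1 ≤ N → ∀ ζN uN : ℝ → ℝ → ℝ,
      IsSemidiscreteSolution γ δ a b c d T μ ζ₀ u₀ N ζN uN →
      ∀ t ∈ Set.Icc 0 T,
        l2norm (fun x => ζN t x - (ζ t).fn x) + l2norm (fun x => uN t x - (u t).fn x)
          ≤ C * (N : ℝ) ^ (-μ)) := by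
  obtain ⟨N₀, C, hC, hex⟩ := hsol.exists_semidiscrete hγ0 hγ1 hδ hb hd hac hT hμ
  have huniq : ∀ {N : ℕ} {ζN uN ζN' uN' : ℝ → ℝ → ℝ},
      IsSemidiscreteSolution γ δ a b c d T μ ζ₀ u₀ N ζN uN →
      IsSemidiscreteSolution γ δ a b c d T μ ζ₀ u₀ N ζN' uN' →
      ∀ t ∈ Set.Icc 0 T, ζN t = ζN' t ∧ uN t = uN' t :=
    fun h h' => h.unique hγ0 hγ1 hδ hb hd hac hT h'
  refine ⟨⟨N₀, fun N hN => ?_⟩, fun N _ ζN uN ζN' uN' h h' => huniq h h', ?_⟩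
  · obtain ⟨ζN, uN, h, -⟩ := hex N hN
    exact ⟨ζN, uN, h⟩
  -- For fixed `N` uniqueness leaves at most one solution on `[0, T]`, so a bound for one is a bound
  -- for all; if there is none, any constant will do.
  have hbound : ∀ N : ℕ, ∃ K : ℝ, 0 ≤ K ∧ ∀ ζN uN : ℝ → ℝ → ℝ,
      IsSemidiscreteSolution γ δ a b c d T μ ζ₀ u₀ N ζN uN → ∀ t ∈ Set.Icc 0 T,
        l2norm (fun x => ζN t x - (ζ t).fn x) + l2norm (fun x => uN t x - (u t).fn x) ≤ K := by
    intro N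
    by_cases hN : ∃ ζN uN, IsSemidiscreteSolution γ δ a b c d T μ ζ₀ u₀ N ζN uN
    · obtain ⟨ζN, uN, h⟩ := hN
      obtain ⟨K₁, hK₁⟩ := exists_l2norm_sub_fn_le hμ hT h.mem_zeta h.diff_zeta
        hsol.contDiffOn_zeta.continuousOn
      obtain ⟨K₂, hK₂⟩ := exists_l2norm_sub_fn_le hμ hT h.mem_u h.diff_u
        hsol.contDiffOn_u.continuousOn
      refine ⟨max 0 (K₁ + K₂), le_max_left _ _, fun ζN' uN' h' t ht => ?_⟩
      rw [(huniq h' h t ht).1, (huniq h' h t ht).2]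
      exact (add_le_add (hK₁ t ht) (hK₂ t ht)).trans (le_max_right _ _)
    · exact ⟨0, le_rfl, fun ζN uN h => absurd ⟨ζN, uN, h⟩ hN⟩
  choose K hK0 hK using hbound
  have hsum : ∀ N, 0 ≤ K N * (N : ℝ) ^ μ := fun N => mul_nonneg (hK0 N) (by positivity)
  have hsum0 : 0 ≤ ∑ N ∈ Finset.range N₀, K N * (N : ℝ) ^ μ := Finset.sum_nonneg fun N _ => hsum N
  -- `C` handles `N ≥ N₀`, the term `K N * N^μ` handles each smaller `N`, and `1` makes the constant
  -- positive.
  refine ⟨C + 1 + ∑ N ∈ Finset.range N₀, K N * (N : ℝ) ^ μ, by positivity,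
    fun N hN ζN uN h t ht => ?_⟩
  have hNpos : (0 : ℝ) < N := by exact_mod_cast hN
  have hpow : (0 : ℝ) < (N : ℝ) ^ (-μ) := Real.rpow_pos_of_pos hNpos _
  rcases le_or_gt N₀ N with hle | hlt
  · obtain ⟨ζN', uN', h', hest⟩ := hex N hle
    rw [(huniq h h' t ht).1, (huniq h h' t ht).2]
    refine (hest t ht).trans (mul_le_mul_of_nonneg_right ?_ hpow.le)
    linarith
  · have h1 := Finset.single_le_sum (fun N _ => hsum N) (Finset.mem_range.2 hlt)
    refine (hK N ζN uN h t ht).trans ?_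
    calc K N = K N * (N : ℝ) ^ μ * (N : ℝ) ^ (-μ) := by
          rw [mul_assoc, ← Real.rpow_add hNpos, add_neg_cancel, Real.rpow_zero, mul_one]
      _ ≤ _ := mul_le_mul_of_nonneg_right (by linarith) hpow.le
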